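/- **Setting.** Let $\phi_j$ ($j\in\frac12+\mathbb Z$) be free Bosons, $\phi_i\phi_j-\phi_j\phi_i=(-1)^{j-1/2}\delta_{i,-j}$, acting on the Fock space $\mathcal F=\mathbb C[\phi_{1/2},\phi_{3/2},\dots]|0\rangle$ with $\phi_{-j}|0\rangle=0$, $\langle0|\phi_j=0$ for $j>0$, $\langle 0|0\rangle=1$; let $\widehat{\mathcal F}$ be its completion for the grading $\deg\phi_j=j$ (formal power series in $\phi_{1/2},\phi_{3/2},\dots$), put $\phi(z)=\sum_{j\in\mathbb Z}\phi_{j+1/2}z^j$ and $:\!\phi_i\phi_j\!:=\phi_i\phi_j-\langle0|\phi_i\phi_j|0\rangle$. Operators $H_n$ ($n$ odd) and $H_{j}$ ($j\in\frac12+\mathbb Z$) are defined by $$\sum_{n\ \mathrm{odd}}H_nz^{-n-1}=-\tfrac12:\!\phi(-z)\phi(z)\!:,\qquad 2\sum_{j\in\frac12+\mathbb Z}H_jz^{-j-1/2}=V_-(z)^{-1}\phi(z)V_+(z)^{-1},\qquad V_\pm(z)=\exp\sum_{\pm k>0,\ k\ \mathrm{odd}}\tfrac2kH_kz^{-k}.$$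 Let $t=(t_1,t_3,t_5,\dots)$, $\xi(t,z)=\sum_{k>0\ \mathrm{odd}}t_kz^k$, $H(t)=\sum_{k>0\ \mathrm{odd}}t_kH_k$, $\langle1|=\langle0|H_{1/2}$. All functions of $t$ are formal power series, and ${\rm Res}_z\sum_ia_iz^i=a_{-1}$. The Lie algebra $c_\infty$ consists of $a+\mu c$, where $a=(a_{ij})_{i,j\in\mathbb Z}$ is a complex matrix with $a_{ij}=(-1)^{i+j+1}a_{-j+1,-i+1}$ and $a_{ij}=0$ for $|i-j|\gg0$, and $\mu\in\mathbb C$; it acts on $\mathcal F$ and $\widehat{\mathcal F}$ by $\hat\pi(a+\mu c)=\frac12\sum_{i,j}(-1)^{j-1}a_{ij}:\!\phi_{i-1/2}\phi_{1/2-j}\!:-\frac\mu2$. An element $g=e^{\hat\pi(a_1)}\cdots e^{\hat\pi(a_r)}$ of $Sp_\infty$ is a finite product of exponentials of elements of $c_\infty$; a vector of $\widehat{\mathcal F}$ is in the domain of $g$ if the exponential series, applied one after the other, converge absolutely coefficient by coefficient, and for $g\in Sp_\infty$ all of $\mathcal F$ is required to be in the domain of $g$. **Proposition.** Let $k$ be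 an odd positive integer, let $g\in Sp_\infty$, and suppose $$g^{-1}H_kg=\sum_{l,j\in\mathbb Z}f_{l,j}\,\phi_{l-\frac12}\phi_{j-\frac12}$$ with constants $f_{l,j}\in\mathbb C$; that is, for every $v\in\mathcal F$ the series $\sum_{l,j}f_{l,j}\phi_{l-1/2}\phi_{j-1/2}v$ converges (unconditionally, in each coefficient) to a vector in the domain of $g$ whose image under $g$ is $H_kgv$. Suppose there are constants $d_l,e_l$ ($l\ge1$) with $$f_{l,j}+f_{j,l}=-(d_le_j+e_ld_j)\qquad\text{for all } l,j\ge1,$$ and that $\sum_{l\ge1}d_l\phi_{l-1/2}|0\rangle$ and $\sum_{j\ge1}e_j\phi_{j-1/2}|0\rangle$ are in the domain of $g$ (automatic if only finitely many $d_l,e_l$ are nonzero). Put $$\tau_0(t)=\langle0|e^{H(t)}g|0\rangle,\qquad \tau_{(2i-1,1)}(t)=\langle0|H_{\frac12}H_{\frac{2i-1}2}e^{H(t)}g|0\rangle\quad(i\ge2),$$ $$\varrho_1(t)=2\langle1|e^{H(t)}g\sum_{l\ge1}d_l\phi_{l-\frac12}|0\rangle,\qquad \varrho_2(t)=2\langle1|e^{H(t)}g\sum_{j\ge1}e_j\phi_{j-\frac12}|0\rangle,$$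 $$g_1(t,z)=e^{\xi(t,z)}\exp\Big(\sum_{j>0\ \mathrm{odd}}\frac2jz^{-j}\frac{\partial}{\partial t_j}\Big)\Big(\frac12\tau_0(t)+2\sum_{i\ge2}\tau_{(2i-1,1)}(t)z^{-i}\Big).$$ Then $g_1(t,z)=\langle1|e^{H(t)}\phi(z)g|0\rangle$, and $${\rm Res}_z\,z^k\,\big(2g_1(t,z)\big)\big(2g_1(t',-z)\big)=\varrho_1(t)\varrho_2(t')+\varrho_2(t)\varrho_1(t').$$ Consequently, if $\tau_0(0)\neq0$, the wave function $w(t,z)=2g_1(t,z)/\tau_0(t)=2\langle1|e^{H(t)}\phi(z)g|0\rangle/\langle0|e^{H(t)}g|0\rangle$ and $q_i=\varrho_i/\tau_0$ satisfy the bilinear equation of the $k$-constrained CKP hierarchy $${\rm Res}_z\,z^kw(t,z)w(t',-z)=q_1(t)q_2(t')+q_2(t)q_1(t').$$ -/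

import Mathlib

open scoped Nat

noncomputable section

namespace CKP

/-! ### The Fock space of the free Bosons

The Boson `φ_{j+1/2}`, `j : ℤ`, is indexed by the integer `j`.  The Fock space is the polynomial
ring in the creation operators `x_n = φ_{n+1/2}`, `n ≥ 0`, applied to the vacuum `|0⟩ = 1`.  Its
completion for the energy grading `deg x_n = n + 1/2` (every graded piece is finite dimensional) is
the ring of formal power series. -/

/-- The completed Fock space; polynomials form the Fock space itself. -/
abbrev Fock := MvPowerSeries ℕ ℂ

/-- The vacuum `|0⟩`. -/
def vac : Fock := 1

/-- The functional `⟨0|`, normalised by `⟨0|0⟩ = 1` and killed by creation operators on its right.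
-/
def vev (u : Fock) : ℂ := MvPowerSeries.constantCoeff u

/-- The free Boson `φ_{j+1/2}`: for `j = n ≥ 0` it multiplies by `x_n`, and
`φ_{-(n+1/2)} = (-1)^n ∂/∂x_n`, so that `φ_i φ_j - φ_j φ_i = (-1)^{j-1/2} δ_{i,-j}` for half-odd
`i`, `j`. -/
def phi : ℤ → Fock →ₗ[ℂ] Fock
  | Int.ofNat n => LinearMap.mulLeft ℂ (MvPowerSeries.X n : Fock)
  | Int.negSucc n => ((-1 : ℂ) ^ n) • (MvPowerSeries.pderiv ℂ n).toLinearMap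

theorem phi_commutator (i j : ℤ) (u : Fock) :
    phi i (phi j u) - phi j (phi i u) = if i = -1 - j then ((-1 : ℂ) ^ j) • u else 0 := by
  rcases i with m | m <;> rcases j with n | n
  · rw [if_neg (by simp only [Int.ofNat_eq_natCast]; omega)]
    simp only [phi, LinearMap.mulLeft_apply]
    ring
  · simp only [phi, LinearMap.mulLeft_apply, LinearMap.smul_apply,
      Derivation.coeFn_coe, Derivation.leibniz, MvPowerSeries.pderiv_X, smul_eq_mul, mul_smul_comm,
      smul_add]
    by_cases h : m = n
    · subst h
      rw [if_pos (by simp only [Int.ofNat_eq_natCast]; omega), zpow_negSucc, pow_succ, mul_inv]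
      rcases neg_one_pow_eq_or ℂ m with h | h <;> simp [h]
    · rw [if_neg (by simp only [Int.ofNat_eq_natCast]; omega)]
      simp [h]
  · simp only [phi, LinearMap.mulLeft_apply, LinearMap.smul_apply,
      Derivation.coeFn_coe, Derivation.leibniz, MvPowerSeries.pderiv_X, smul_eq_mul, mul_smul_comm,
      smul_add]
    by_cases h : m = n
    · subst h
      rw [if_pos (by simp only [Int.ofNat_eq_natCast]; omega)]
      simp
    · rw [if_neg (by simp only [Int.ofNat_eq_natCast]; omega)]
      simp [Ne.symm h]
  · rw [if_neg (by omega)]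
    ext μ
    by_cases h : m = n
    · subst h; simp
    · simp only [phi, LinearMap.smul_apply, Derivation.coeFn_coe,
        map_smul, map_sub, MvPowerSeries.coeff_pderiv, smul_eq_mul, map_zero]
      rw [add_right_comm]
      simp [h, Ne.symm h]
      ring

theorem phi_neg_vac (j : ℤ) (hj : j < 0) : phi j vac = 0 := by
  rcases j with n | n
  · simp only [Int.ofNat_eq_natCast] at hj; omega
  · simp [phi, vac]

theorem vev_phi (j : ℤ) (hj : 0 ≤ j) (u : Fock) : vev (phi j u) = 0 := by
  rcases j with n | n
  · simp [phi, vev]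
  · omega

/-- The normally ordered product
`:φ_{i+1/2} φ_{j+1/2}: = φ_{i+1/2} φ_{j+1/2} - ⟨0|φ_{i+1/2} φ_{j+1/2}|0⟩`. -/
def nord (i j : ℤ) (u : Fock) : Fock := phi i (phi j u) - vev (phi i (phi j vac)) • u

/-- The operator `H_n`, the coefficient of `z^{-n-1}` in `-(1/2) :φ(-z)φ(z):` for
`φ(z) = ∑_i φ_{i+1/2} z^i`.  In every coefficient only finitely many terms are nonzero (`n ≠ 0`). -/
def Hop (n : ℤ) (u : Fock) : Fock := fun μ =>
  -(1 / 2 : ℂ) * ∑ᶠ i : ℤ, (-1 : ℂ) ^ i * MvPowerSeries.coeff μ (nord i (-n - 1 - i) u)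

/-! ### Exponentials of operator valued series -/

section Exp

variable {M : Type} [AddCommGroup M] [Module ℂ M]

/-- Multiplication by `∑_{k ≥ 1} A_k ζ^k` on series `∑_b U_b ζ^b` with coefficients in `M`. -/
def stepOp (A : ℕ → M → M) (U : ℕ → M) : ℕ → M := fun b =>
  ∑ k ∈ Finset.Icc 1 b, A k (U (b - k))

/-- The coefficient of `ζ^b` in `exp (∑_{k ≥ 1} A_k ζ^k) u`; the terms of the exponential series of
index greater than `b` do not contribute to it. -/
def expCoeff (A : ℕ → M → M) (u : M) (b : ℕ) : M :=
  ∑ N ∈ Finset.range (b + 1), ((N ! : ℂ)⁻¹) • ((stepOp A)^[N] (Pi.single 0 u)) b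

end Exp

/-! ### The operators of half-odd index -/

/-- The coefficient of `z^{-b}` in `V_+(z)^{-1} = exp (-∑_{k > 0 odd} (2/k) H_k z^{-k})`. -/
def VplusInv (b : ℕ) (u : Fock) : Fock :=
  expCoeff (fun k v => if Odd k then (-(2 / (k : ℂ))) • Hop k v else 0) u b

/-- The coefficient of `z^a` in
`V_-(z)^{-1} = exp (-∑_{k < 0 odd} (2/k) H_k z^{-k}) = exp (∑_{k > 0 odd} (2/k) H_{-k} z^k)`. -/
def VminusInv (a : ℕ) (u : Fock) : Fock :=
  expCoeff (fun k v => if Odd k then (2 / (k : ℂ)) • Hop (-(k : ℤ)) v else 0) u a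

/-- The operator `H_{m-1/2}`, half the coefficient of `z^{-m}` in
`V_-(z)^{-1} φ(z) V_+(z)^{-1} = 2 ∑_m H_{m-1/2} z^{-m}`.  In every coefficient only finitely many
terms are nonzero. -/
def Hhalf (m : ℤ) (u : Fock) : Fock := fun μ =>
  (1 / 2 : ℂ) * ∑ᶠ p : ℕ × ℕ,
    MvPowerSeries.coeff μ (VminusInv p.1 (phi (-m - p.1 + p.2) (VplusInv p.2 u)))

/-! ### The Lie algebra `c_∞`, its representation, and the group `Sp_∞` -/

/-- The elements `mat + central * c` of `c_∞`. -/
structure CInf where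
  mat : ℤ → ℤ → ℂ
  central : ℂ
  symm : ∀ i j : ℤ, mat i j = (-1 : ℂ) ^ (i + j + 1) * mat (-j + 1) (-i + 1)
  band : ∃ N : ℤ, ∀ i j : ℤ, N < |i - j| → mat i j = 0

/-- The representation of `c_∞` on the (completed) Fock space: with
`Z_{i,j} = E_{i,j} - (-1)^{i+j} E_{-j+1,-i+1}` one has `(a_{ij}) = (1/2) ∑ a_{ij} Z_{i,j}`, the
operator of `Z_{i,j}` is `(-1)^{j-1} :φ_{i-1/2} φ_{1/2-j}:`, and that of `c` is `-1/2`.  By the band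
condition only finitely many terms are nonzero in every coefficient. -/
def rep (a : CInf) (u : Fock) : Fock := fun μ =>
  (1 / 2 : ℂ) * (∑ᶠ p : ℤ × ℤ, a.mat p.1 p.2 * (-1 : ℂ) ^ (p.2 - 1) *
    MvPowerSeries.coeff μ (nord (p.1 - 1) (-p.2) u))
  - (1 / 2 : ℂ) * a.central * MvPowerSeries.coeff μ u

/-- The exponential series `∑_n A^n u / n!` converges absolutely, coefficient by coefficient. -/
def ExpDefined (A : Fock → Fock) (u : Fock) : Prop :=
  ∀ μ : ℕ →₀ ℕ, Summable fun n : ℕ => (n ! : ℂ)⁻¹ * MvPowerSeries.coeff μ (A^[n] u)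

/-- The value `e^A u = ∑_n A^n u / n!`. -/
def expOp (A : Fock → Fock) (u : Fock) : Fock := fun μ =>
  ∑' n : ℕ, (n ! : ℂ)⁻¹ * MvPowerSeries.coeff μ (A^[n] u)

/-- The operator `g = e^{π(a₁)} e^{π(a₂)} ⋯ e^{π(a_r)}` given by the list `[a₁, …, a_r]`. -/
def act : List CInf → Fock → Fock
  | [], u => u
  | a :: g, u => expOp (rep a) (act g u)

/-- The vector `u` is in the domain of `g = e^{π(a₁)} ⋯ e^{π(a_r)}`: all the exponentials, applied
one after the other, converge. -/
def InDom : List CInf → Fock → Prop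
  | [], _ => True
  | a :: g, u => InDom g u ∧ ExpDefined (rep a) (act g u)

/-- `g = e^{π(a₁)} ⋯ e^{π(a_r)}` is an element of `Sp_∞`: it is defined on the Fock space (and takes
values in its completion). -/
def InSp (g : List CInf) : Prop :=
  ∀ v : MvPolynomial ℕ ℂ, InDom g (v : Fock)

/-- The operator identity `g⁻¹ H_k g = ∑_{l,j ∈ ℤ} f_{l,j} φ_{l-1/2} φ_{j-1/2}` on the Fock space:
for every `v` in the Fock space, the series `∑ f_{l,j} φ_{l-1/2} φ_{j-1/2} v` converges to a vector
`u` in the domain of `g`, and `H_k g v = g u`. -/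
def ConjEq (g : List CInf) (k : ℕ) (f : ℤ → ℤ → ℂ) : Prop :=
  ∀ v : MvPolynomial ℕ ℂ, ∃ u : Fock,
    (∀ μ : ℕ →₀ ℕ, HasSum
      (fun p : ℤ × ℤ => f p.1 p.2 *
        MvPowerSeries.coeff μ (phi (p.1 - 1) (phi (p.2 - 1) (v : Fock))))
      (MvPowerSeries.coeff μ u)) ∧
    InDom g u ∧ Hop k (act g (v : Fock)) = act g u

/-- The vector `∑_{l ≥ 1} d_l φ_{l-1/2} |0⟩`. -/
def lin (d : ℕ → ℂ) : Fock := fun μ =>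
  ∑ᶠ l : ℕ, d (l + 1) * MvPowerSeries.coeff μ (phi l vac)

/-! ### Formal power series in the times `t = (t_1, t_3, t_5, …)`

The variable `X p` stands for `t_{2p+1}`. -/

/-- Formal power series in `t_1, t_3, t_5, …`. -/
abbrev Times := MvPowerSeries ℕ ℂ

/-- Multiplication by `H(t) = ∑_p t_{2p+1} H_{2p+1}` on power series in `t` whose coefficients are
in the completed Fock space (`U n` is the coefficient of the monomial `t^n`). -/
def hStep (U : (ℕ →₀ ℕ) → Fock) : (ℕ →₀ ℕ) → Fock := fun n =>
  ∑ p ∈ n.support, Hop (2 * (p : ℤ) + 1) (U (n - Finsupp.single p 1))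

/-- The coefficient of `t^n` in `e^{H(t)} u`; only terms of the exponential series of index at most
the total degree of `n` contribute to it. -/
def expH (u : Fock) (n : ℕ →₀ ℕ) : Fock :=
  ∑ N ∈ Finset.range (n.degree + 1), ((N ! : ℂ)⁻¹) • (hStep^[N] (Pi.single 0 u)) n

/-- `⟨0|e^{H(t)} u`. -/
def braZero (u : Fock) : Times := fun n => vev (expH u n)

/-- `⟨1|e^{H(t)} u`, where `⟨1| = ⟨0|H_{1/2}`. -/
def braOne (u : Fock) : Times := fun n => vev (Hhalf 1 (expH u n))

/-- `τ_0(t) = ⟨0|e^{H(t)} g|0⟩`. -/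
def tauZero (g : List CInf) : Times := braZero (act g vac)

/-- `τ_{(2i-1,1)}(t) = ⟨0|H_{1/2} H_{(2i-1)/2} e^{H(t)} g|0⟩`. -/
def tauPair (g : List CInf) (i : ℕ) : Times := fun n =>
  vev (Hhalf 1 (Hhalf i (expH (act g vac) n)))

/-- `2⟨1|e^{H(t)} g ∑_{l ≥ 1} d_l φ_{l-1/2}|0⟩`. -/
def rho (g : List CInf) (d : ℕ → ℂ) : Times := (2 : ℂ) • braOne (act g (lin d))

/-! ### Wave functions

A formal series `∑_{i ∈ ℤ} w_i(t) z^i` is given by its coefficients `w : ℤ → Times`. -/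

/-- The coefficient of `z^a` in `e^{ξ(t,z)}`, `ξ(t,z) = ∑_{k odd} t_k z^k`. -/
def expXi (a : ℕ) : Times :=
  expCoeff (fun k F => if Odd k then (MvPowerSeries.X ((k - 1) / 2) : Times) * F else 0) 1 a

/-- The coefficient of `z^{-b}` in `exp (∑_{k odd} (2/k) z^{-k} ∂/∂t_k) F(t)`. -/
def shift (F : Times) (b : ℕ) : Times :=
  expCoeff (fun k G => if Odd k then
    (2 / (k : ℂ)) • MvPowerSeries.pderiv ℂ ((k - 1) / 2) G else 0) F b

/-- The coefficient of `z^{-b}` in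
`exp (∑_{k odd} (2/k) z^{-k} ∂/∂t_k) (τ_0(t)/2 + 2 ∑_{i ≥ 2} τ_{(2i-1,1)}(t) z^{-i})`. -/
def tauShift (τ₀ : Times) (τ : ℕ → Times) (b : ℕ) : Times :=
  (1 / 2 : ℂ) • shift τ₀ b + (2 : ℂ) • ∑ i ∈ Finset.Icc 2 b, shift (τ i) (b - i)

/-- The coefficient of `z^i` in `g_1(t,z) =
e^{ξ(t,z)} exp (∑ (2/k) z^{-k} ∂/∂t_k) (τ_0(t)/2 + 2 ∑_{i ≥ 2} τ_{(2i-1,1)}(t) z^{-i})`. -/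
def waveNum (τ₀ : Times) (τ : ℕ → Times) (i : ℤ) : Times := fun n =>
  ∑ᶠ a : ℕ, if i ≤ (a : ℤ) then
    MvPowerSeries.coeff n (expXi a * tauShift τ₀ τ ((a : ℤ) - i).toNat) else 0

/-- The coefficient of `z^i` in the wave function `w(t,z) = 2 g_1(t,z) / τ_0(t)` of the tau
functions. -/
def wave (τ₀ : Times) (τ : ℕ → Times) (i : ℤ) : Times :=
  (2 : ℂ) • (τ₀⁻¹ * waveNum τ₀ τ i)

/-- The bilinear equation
`Res_z z^k w(t,z) w(t',-z) = q₁(t) q₂(t') + q₂(t) q₁(t')` as an identity of formal power series in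
two independent sets of times `t`, `t'`: the coefficients of every `t^α t'^β` agree.  The residue is
the sum over `i + j = -k - 1` of `(-1)^j w_i(t) w_j(t')`. -/
def BilinearEq (k : ℕ) (w : ℤ → Times) (q₁ q₂ : Times) : Prop :=
  ∀ α β : ℕ →₀ ℕ,
    (∑ᶠ i : ℤ, (-1 : ℂ) ^ (-(k : ℤ) - 1 - i) * MvPowerSeries.coeff α (w i) *
      MvPowerSeries.coeff β (w (-(k : ℤ) - 1 - i))) =
    MvPowerSeries.coeff α q₁ * MvPowerSeries.coeff β q₂ +
      MvPowerSeries.coeff α q₂ * MvPowerSeries.coeff β q₁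

end CKP

end

open scoped Nat

noncomputable section

namespace CKP

/-! Index the Bosons by integers as in `phi` and let S = ∑_j (-1)^j φ_j ⊗ φ_{-1-j}. The Bosons span
a symplectic space on which a normally ordered quadratic operator T acts, by commutators, through
the symplectic Lie algebra. S is the invariant tensor of that space, so it commutes with T ⊗ 1 + 1 ⊗
T (`pairing_quadComm`), and after exponentiation with g ⊗ g (`PairingEq.act`). In every term of S
one factor kills the vacuum, whence S(g|0⟩ ⊗ g|0⟩) = 0 (`pairing_act_vac`).

For odd k, [H_k, φ_j] = φ_{j-k}. Moving H_k ⊗ 1 through S therefore identifies S(H_k g|0⟩ ⊗ g|0⟩)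
with Res_z z^k φ(z)g|0⟩ ⊗ φ(-z)g|0⟩ (`pairing_HopL`). By hypothesis H_k g|0⟩ = g u with u = ∑
f_{l,j} φφ|0⟩, so the residue is also (g ⊗ g) S(u ⊗ |0⟩). Contracting u with annihilators leaves
only f_{l,j} + f_{j,l} for l, j ≥ 1, and the assumed form of this matrix turns S(u ⊗ |0⟩) into D ⊗ E
+ E ⊗ D with D, E the vectors `lin d`, `lin e` (`pairing_vac`). Applying ⟨1|e^{H(t)} ⊗ ⟨1|e^{H(t')}
gives the bilinear equation.

For the formula for g_1, e^{H(t)} φ(z) = e^{ξ(t,z)} φ(z) e^{H(t)} (`coeff_bra_phi`) and ⟨1| =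
½⟨0|φ_{-1/2}. Since ⟨0| and ⟨0|φ_{-1/2} both annihilate H_{-n} for odd n > 0, V_-(z) is invisible to
them, and ⟨0|φ_{-1/2} φ(z) = 4 ∑_i ⟨0|H_{1/2} H_{i-1/2} z^{-i} V_+(z) (`sum_gam_comp`). In front of
e^{H(t)}, V_+(z) becomes the shift of the times (`shift_bra`).

Identities in a completed tensor square are tested against κ ⊗ κ' with κ, κ' depending on finitely
many coefficients. All sums over Boson indices then become finite, and coefficientwise limits may be
taken under κ. -/

/-! ### Local functionals and operators -/

/-- A functional on the completed Fock space that depends on finitely many coefficients. -/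
def IsLocal (κ : Fock →ₗ[ℂ] ℂ) : Prop :=
  ∃ S : Finset (ℕ →₀ ℕ), ∀ u : Fock, (∀ μ ∈ S, MvPowerSeries.coeff μ u = 0) → κ u = 0

/-- An operator all of whose coefficients are local functionals. -/
def IsLocalOp (T : Fock →ₗ[ℂ] Fock) : Prop :=
  ∀ μ, IsLocal (MvPowerSeries.coeff μ ∘ₗ T)

theorem isLocal_coeff (μ : ℕ →₀ ℕ) : IsLocal (MvPowerSeries.coeff μ) :=
  ⟨{μ}, fun u hu => hu μ (by simp)⟩

theorem isLocal_zero : IsLocal 0 := ⟨∅, fun _ _ => rfl⟩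

theorem IsLocal.add {κ κ' : Fock →ₗ[ℂ] ℂ} (h : IsLocal κ) (h' : IsLocal κ') :
    IsLocal (κ + κ') := by
  classical
  obtain ⟨S, hS⟩ := h
  obtain ⟨S', hS'⟩ := h'
  refine ⟨S ∪ S', fun u hu => ?_⟩
  rw [LinearMap.add_apply, hS u fun μ hμ => hu μ (Finset.mem_union_left _ hμ),
    hS' u fun μ hμ => hu μ (Finset.mem_union_right _ hμ), add_zero]

theorem IsLocal.smul {κ : Fock →ₗ[ℂ] ℂ} (h : IsLocal κ) (c : ℂ) : IsLocal (c • κ) := by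
  obtain ⟨S, hS⟩ := h
  exact ⟨S, fun u hu => by rw [LinearMap.smul_apply, hS u hu, smul_zero]⟩

theorem isLocal_sum {ι : Type*} (s : Finset ι) (κ : ι → Fock →ₗ[ℂ] ℂ)
    (h : ∀ i ∈ s, IsLocal (κ i)) : IsLocal (∑ i ∈ s, κ i) :=
  Finset.sum_induction _ _ (fun _ _ => IsLocal.add) isLocal_zero h

theorem IsLocal.comp {κ : Fock →ₗ[ℂ] ℂ} (h : IsLocal κ) {T : Fock →ₗ[ℂ] Fock}
    (hT : IsLocalOp T) : IsLocal (κ ∘ₗ T) := by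
  classical
  obtain ⟨S, hS⟩ := h
  choose F hF using hT
  refine ⟨S.biUnion F, fun u hu => hS _ fun μ hμ => hF μ u fun ν hν => hu ν ?_⟩
  exact Finset.mem_biUnion.2 ⟨μ, hμ, hν⟩

theorem IsLocalOp.comp {T T' : Fock →ₗ[ℂ] Fock} (h : IsLocalOp T) (h' : IsLocalOp T') :
    IsLocalOp (T ∘ₗ T') := fun μ => (h μ).comp h'

theorem IsLocalOp.smul {T : Fock →ₗ[ℂ] Fock} (h : IsLocalOp T) (c : ℂ) : IsLocalOp (c • T) :=
  fun μ => by
    rw [LinearMap.comp_smul]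
    exact (h μ).smul c

theorem IsLocalOp.add {T T' : Fock →ₗ[ℂ] Fock} (h : IsLocalOp T) (h' : IsLocalOp T') :
    IsLocalOp (T + T') := fun μ => by
  rw [LinearMap.comp_add]
  exact (h μ).add (h' μ)

theorem IsLocalOp.sub {T T' : Fock →ₗ[ℂ] Fock} (h : IsLocalOp T) (h' : IsLocalOp T') :
    IsLocalOp (T - T') := by
  rw [sub_eq_add_neg, ← neg_one_smul ℂ T']
  exact h.add (h'.smul _)

theorem isLocalOp_id : IsLocalOp LinearMap.id := fun μ => isLocal_coeff μ

/-- A local functional is a finite linear combination of coefficients. -/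
theorem IsLocal.exists_eq_sum {κ : Fock →ₗ[ℂ] ℂ} (h : IsLocal κ) :
    ∃ S : Finset (ℕ →₀ ℕ), ∀ u,
      κ u = ∑ μ ∈ S, κ (MvPowerSeries.monomial μ 1) * MvPowerSeries.coeff μ u := by
  classical
  obtain ⟨S, hS⟩ := h
  refine ⟨S, fun u => ?_⟩
  have h0 : κ (u - ∑ μ ∈ S, MvPowerSeries.coeff μ u • MvPowerSeries.monomial μ (1 : ℂ)) = 0 := by
    refine hS _ fun ν hν => ?_
    rw [map_sub, map_sum, Finset.sum_eq_single ν]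
    · rw [map_smul, MvPowerSeries.coeff_monomial_same]
      simp
    · intro μ _ hμ
      rw [map_smul, MvPowerSeries.coeff_monomial_ne hμ.symm, smul_zero]
    · exact fun h => absurd hν h
  rw [map_sub, sub_eq_zero, map_sum] at h0
  rw [h0]
  exact Finset.sum_congr rfl fun μ _ => by rw [map_smul, smul_eq_mul, mul_comm]

/-! ### The Bosons and their normally ordered products -/

theorem isLocalOp_phi (j : ℤ) : IsLocalOp (phi j) := by
  classical
  intro μ
  rcases j with n | n
  · by_cases h : Finsupp.single n 1 ≤ μ
    · refine ⟨{μ - Finsupp.single n 1}, fun u hu => ?_⟩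
      have := hu _ (Finset.mem_singleton_self _)
      simp only [phi, LinearMap.comp_apply, LinearMap.mulLeft_apply]
      rw [MvPowerSeries.X_mul, MvPowerSeries.X, MvPowerSeries.coeff_mul_monomial, if_pos h, this,
        zero_mul]
    · refine ⟨∅, fun u _ => ?_⟩
      simp only [phi, LinearMap.comp_apply, LinearMap.mulLeft_apply]
      rw [MvPowerSeries.X_mul, MvPowerSeries.X, MvPowerSeries.coeff_mul_monomial, if_neg h]
  · refine ⟨{μ + Finsupp.single n 1}, fun u hu => ?_⟩
    have := hu _ (Finset.mem_singleton_self _)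
    simp only [phi, LinearMap.comp_apply, LinearMap.smul_apply, Derivation.coeFn_coe, map_smul]
    rw [MvPowerSeries.coeff_pderiv, this, zero_mul, smul_zero]

/-- A bound for the indices of the variables in a monomial. -/
def varBound (μ : ℕ →₀ ℕ) : ℕ := μ.support.sup (· + 1)

theorem coeff_phi_eq_zero {μ : ℕ →₀ ℕ} {j : ℤ} (hj : (varBound μ : ℤ) ≤ j) (u : Fock) :
    MvPowerSeries.coeff μ (phi j u) = 0 := by
  classical
  rcases j with n | n
  · simp only [phi, LinearMap.mulLeft_apply]
    rw [MvPowerSeries.X_mul, MvPowerSeries.X, MvPowerSeries.coeff_mul_monomial, if_neg]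
    intro h
    have h1 : n ∈ μ.support := by
      have := h n
      simp only [Finsupp.single_eq_same] at this
      exact Finsupp.mem_support_iff.2 (by omega)
    have h2 : n + 1 ≤ varBound μ := Finset.le_sup (f := fun x => x + 1) h1
    simp only [Int.ofNat_eq_natCast] at hj
    omega
  · omega

/-- Only finitely many variables occur in the monomials seen by κ, and a multiple of any other
variable has none of these monomials. -/
theorem IsLocal.exists_phi_eq_zero {κ : Fock →ₗ[ℂ] ℂ} (h : IsLocal κ) :
    ∃ M : ℤ, ∀ j, M ≤ j → ∀ u, κ (phi j u) = 0 := by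
  obtain ⟨S, hS⟩ := h
  refine ⟨(S.sup varBound : ℕ), fun j hj u => hS _ fun μ hμ => coeff_phi_eq_zero ?_ u⟩
  have : varBound μ ≤ S.sup varBound := Finset.le_sup hμ
  omega

/-- The normally ordered product as a linear map. -/
def nordL (i j : ℤ) : Fock →ₗ[ℂ] Fock :=
  phi i ∘ₗ phi j - vev (phi i (phi j vac)) • LinearMap.id

theorem nordL_apply (i j : ℤ) (u : Fock) : nordL i j u = nord i j u := rfl

theorem isLocalOp_nordL (i j : ℤ) : IsLocalOp (nordL i j) :=
  ((isLocalOp_phi i).comp (isLocalOp_phi j)).sub (isLocalOp_id.smul _)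

theorem phi_phi (i j : ℤ) (u : Fock) :
    phi i (phi j u) = phi j (phi i u) + (if i = -1 - j then (-1 : ℂ) ^ j else 0) • u := by
  have := phi_commutator i j u
  rw [sub_eq_iff_eq_add] at this
  rw [this, add_comm]
  split_ifs <;> simp

/-- The commutator is a scalar, so subtracting the vacuum expectation removes it. -/
theorem nord_comm (i j : ℤ) (u : Fock) : nord i j u = nord j i u := by
  unfold nord
  have h : vev (phi i (phi j vac)) =
      vev (phi j (phi i vac)) + (if i = -1 - j then (-1 : ℂ) ^ j else 0) := by
    rw [phi_phi i j vac]
    simp only [vev, vac, map_add]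
    split_ifs <;> simp
  rw [h, phi_phi i j u, add_smul]
  abel

theorem coeff_nord_eq_zero_left {μ : ℕ →₀ ℕ} {i : ℤ} (hi : (varBound μ : ℤ) ≤ i) (j : ℤ)
    (u : Fock) : MvPowerSeries.coeff μ (nord i j u) = 0 := by
  unfold nord
  rw [vev_phi i (by omega), zero_smul, sub_zero, coeff_phi_eq_zero hi]

theorem coeff_nord_eq_zero_right {μ : ℕ →₀ ℕ} {j : ℤ} (hj : (varBound μ : ℤ) ≤ j) (i : ℤ)
    (u : Fock) : MvPowerSeries.coeff μ (nord i j u) = 0 := by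
  rw [nord_comm, coeff_nord_eq_zero_left hj]

theorem nord_phi_sub (i j m : ℤ) (u : Fock) :
    nord i j (phi m u) - phi m (nord i j u) =
      (-1 : ℂ) ^ m • ((if j = -1 - m then phi i u else 0) + if i = -1 - m then phi j u else 0) := by
  unfold nord
  rw [map_sub, map_smul, phi_phi j m, map_add, phi_phi i m, map_smul]
  split_ifs <;> simp
  all_goals abel

/-! ### Normally ordered quadratic operators with band-limited coefficients -/

/-- The coefficients `b i j` vanish unless `i + j` is bounded. -/
def Band (b : ℤ → ℤ → ℂ) : Prop := ∃ N : ℤ, ∀ i j : ℤ, N < |i + j| → b i j = 0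

/-- The box in which the indices of the terms contributing to the coefficient of `μ` lie. -/
def quadBox (N : ℤ) (μ : ℕ →₀ ℕ) : Finset (ℤ × ℤ) :=
  Finset.Icc (-N - varBound μ) (varBound μ) ×ˢ Finset.Icc (-N - varBound μ) (varBound μ)

theorem quad_support {b : ℤ → ℤ → ℂ} {N : ℤ} (hN : ∀ i j : ℤ, N < |i + j| → b i j = 0)
    (μ : ℕ →₀ ℕ) (p : ℤ × ℤ) (hp : p ∉ quadBox N μ) (u : Fock) :
    b p.1 p.2 * MvPowerSeries.coeff μ (nord p.1 p.2 u) = 0 := by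
  by_cases h1 : (varBound μ : ℤ) ≤ p.1
  · rw [coeff_nord_eq_zero_left h1, mul_zero]
  by_cases h2 : (varBound μ : ℤ) ≤ p.2
  · rw [coeff_nord_eq_zero_right h2, mul_zero]
  rw [hN, zero_mul]
  by_contra h
  rw [not_lt, abs_le] at h
  exact hp (by simp only [quadBox, Finset.mem_product, Finset.mem_Icc]; omega)

/-- The operator `∑ b_{i,j} :φ_{i+1/2} φ_{j+1/2}:`. -/
def quad (b : ℤ → ℤ → ℂ) (u : Fock) : Fock := fun μ =>
  ∑ᶠ p : ℤ × ℤ, b p.1 p.2 * MvPowerSeries.coeff μ (nord p.1 p.2 u)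

theorem coeff_quad {b : ℤ → ℤ → ℂ} {N : ℤ} (hN : ∀ i j : ℤ, N < |i + j| → b i j = 0)
    (μ : ℕ →₀ ℕ) {B : Finset (ℤ × ℤ)} (hB : quadBox N μ ⊆ B) (u : Fock) :
    MvPowerSeries.coeff μ (quad b u) =
      ∑ p ∈ B, b p.1 p.2 * MvPowerSeries.coeff μ (nordL p.1 p.2 u) := by
  change (∑ᶠ p : ℤ × ℤ, b p.1 p.2 * MvPowerSeries.coeff μ (nord p.1 p.2 u)) = _
  refine finsum_eq_sum_of_support_subset _ fun p hp => ?_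
  by_contra h
  exact hp (quad_support hN μ p (fun h' => h (hB h')) u)

/-- `quad b` as a linear map. -/
def quadL (b : ℤ → ℤ → ℂ) (hb : Band b) : Fock →ₗ[ℂ] Fock where
  toFun := quad b
  map_add' u v := by
    obtain ⟨N, hN⟩ := hb
    ext μ
    rw [map_add]
    simp only [coeff_quad hN μ subset_rfl, map_add, mul_add, Finset.sum_add_distrib]
  map_smul' c u := by
    obtain ⟨N, hN⟩ := hb
    ext μ
    rw [RingHom.id_apply, map_smul]
    simp only [coeff_quad hN μ subset_rfl, map_smul, smul_eq_mul, Finset.mul_sum]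
    exact Finset.sum_congr rfl fun _ _ => by ring

theorem quadL_apply {b : ℤ → ℤ → ℂ} (hb : Band b) (u : Fock) : quadL b hb u = quad b u := rfl

theorem coeff_comp_quadL {b : ℤ → ℤ → ℂ} (hb : Band b) (μ : ℕ →₀ ℕ) :
    ∃ B₀ : Finset (ℤ × ℤ), ∀ B, B₀ ⊆ B → MvPowerSeries.coeff μ ∘ₗ quadL b hb =
      ∑ p ∈ B, b p.1 p.2 • (MvPowerSeries.coeff μ ∘ₗ nordL p.1 p.2) := by
  obtain ⟨N, hN⟩ := id hb
  refine ⟨quadBox N μ, fun B hB => LinearMap.ext fun u => ?_⟩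
  rw [LinearMap.comp_apply, quadL_apply, coeff_quad hN μ hB]
  simp

theorem isLocalOp_quadL {b : ℤ → ℤ → ℂ} (hb : Band b) : IsLocalOp (quadL b hb) := fun μ => by
  obtain ⟨B, hB⟩ := coeff_comp_quadL hb μ
  rw [hB B subset_rfl]
  exact isLocal_sum _ _ fun p _ => (isLocalOp_nordL p.1 p.2 μ).smul _

/-- Allowing every larger box `B` lets several functionals be expanded over a common one. -/
theorem IsLocal.comp_quadL {κ : Fock →ₗ[ℂ] ℂ} (h : IsLocal κ) {b : ℤ → ℤ → ℂ} (hb : Band b) :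
    ∃ B₀ : Finset (ℤ × ℤ), ∀ B, B₀ ⊆ B → ∀ u,
      κ (quadL b hb u) = ∑ p ∈ B, b p.1 p.2 * κ (nordL p.1 p.2 u) := by
  classical
  obtain ⟨S, hS⟩ := h
  choose F hF using coeff_comp_quadL hb
  refine ⟨S.biUnion F, fun B hB u => ?_⟩
  have h0 : κ (quadL b hb u - ∑ p ∈ B, b p.1 p.2 • nordL p.1 p.2 u) = 0 := by
    refine hS _ fun μ hμ => ?_
    rw [map_sub, sub_eq_zero, ← LinearMap.comp_apply,
      hF μ B ((Finset.subset_biUnion_of_mem F hμ).trans hB)]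
    simp
  rw [map_sub, sub_eq_zero, map_sum] at h0
  simpa using h0

/-- The matrix of the adjoint action of `quad b` on the Bosons. -/
def quadComm (b : ℤ → ℤ → ℂ) (i m : ℤ) : ℂ := (-1 : ℂ) ^ m * (b i (-1 - m) + b (-1 - m) i)

theorem finite_support_quadComm {b : ℤ → ℤ → ℂ} (hb : Band b) (m : ℤ) :
    {i | quadComm b i m ≠ 0}.Finite := by
  obtain ⟨N, hN⟩ := hb
  refine (Set.finite_Icc (m + 1 - N) (m + 1 + N)).subset fun i hi => ?_
  by_contra h
  refine hi ?_
  have h' : N < |i + (-1 - m)| := by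
    by_contra h'
    rw [not_lt, abs_le] at h'
    exact h (by simp only [Set.mem_Icc]; omega)
  rw [quadComm, hN _ _ h', hN _ _ (by rwa [add_comm]), add_zero, mul_zero]

theorem IsLocal.quadL_phi {κ : Fock →ₗ[ℂ] ℂ} (h : IsLocal κ) {b : ℤ → ℤ → ℂ} (hb : Band b)
    (m : ℤ) (u : Fock) :
    κ (quadL b hb (phi m u)) - κ (phi m (quadL b hb u)) =
      ∑ᶠ i, quadComm b i m * κ (phi i u) := by
  classical
  obtain ⟨B₁, hB₁⟩ := h.comp_quadL hb
  obtain ⟨B₂, hB₂⟩ := (h.comp (isLocalOp_phi m)).comp_quadL hb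
  -- The square s × s contains both boxes. Including -1 - m makes each Kronecker delta from
  -- `nord_phi_sub` fall inside the range of summation.
  set s : Finset ℤ := (finite_support_quadComm hb m).toFinset ∪ ((B₁ ∪ B₂).image Prod.fst ∪
    (B₁ ∪ B₂).image Prod.snd) ∪ {-1 - m} with hs
  have hsub : B₁ ∪ B₂ ⊆ s ×ˢ s := fun p hp => by
    simp only [hs, Finset.mem_product]
    exact ⟨Finset.mem_union_left _ (Finset.mem_union_right _ (Finset.mem_union_left _
        (Finset.mem_image_of_mem _ hp))),
      Finset.mem_union_left _ (Finset.mem_union_right _ (Finset.mem_union_right _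
        (Finset.mem_image_of_mem _ hp)))⟩
  have h2 := hB₂ (s ×ˢ s) (Finset.subset_union_right.trans hsub) u
  rw [LinearMap.comp_apply] at h2
  rw [hB₁ (s ×ˢ s) (Finset.subset_union_left.trans hsub), h2, ← Finset.sum_sub_distrib,
    finsum_eq_sum_of_support_subset (s := s)]
  · have hm : -1 - m ∈ s := by simp [hs]
    have key : ∀ p : ℤ × ℤ, b p.1 p.2 * κ (nordL p.1 p.2 (phi m u)) -
        b p.1 p.2 * (κ ∘ₗ phi m) (nordL p.1 p.2 u) =
        (if p.2 = -1 - m then (-1 : ℂ) ^ m * b p.1 p.2 * κ (phi p.1 u) else 0) +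
        (if p.1 = -1 - m then (-1 : ℂ) ^ m * b p.1 p.2 * κ (phi p.2 u) else 0) := by
      intro p
      rw [← mul_sub, LinearMap.comp_apply, ← map_sub, nordL_apply, nordL_apply, nord_phi_sub,
        map_smul, map_add]
      split_ifs <;> simp <;> ring
    simp only [key, Finset.sum_add_distrib, Finset.sum_product]
    rw [Finset.sum_comm (f := fun x y => if x = -1 - m then _ else _)]
    simp only [Finset.sum_ite_eq', if_pos hm, ← Finset.sum_add_distrib, quadComm]
    exact Finset.sum_congr rfl fun i _ => by ring
  · intro i hi
    have : quadComm b i m ≠ 0 := fun h0 => hi (by simp [h0])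
    exact Finset.mem_coe.2 (Finset.mem_union_left _ (Finset.mem_union_left _ (by simpa using this)))

/-- The operator `T` acts on the Bosons by commutators as `quad b` does. -/
def HasQuadComm (T : Fock →ₗ[ℂ] Fock) (b : ℤ → ℤ → ℂ) : Prop :=
  ∀ κ : Fock →ₗ[ℂ] ℂ, IsLocal κ → ∀ (m : ℤ) (u : Fock),
    κ (T (phi m u)) - κ (phi m (T u)) = ∑ᶠ i, quadComm b i m * κ (phi i u)

/-! ### The operators `H_n` and the representation of `c_∞` as quadratic operators -/

/-- The coefficients of `H_n`. -/
def hopCoeff (n i j : ℤ) : ℂ := if i + j = -n - 1 then -(1 / 2 : ℂ) * (-1 : ℂ) ^ i else 0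

theorem band_hopCoeff (n : ℤ) : Band (hopCoeff n) :=
  ⟨|-n - 1|, fun i j h => if_neg fun h' => by rw [h'] at h; exact lt_irrefl _ h⟩

theorem Hop_eq_quad (n : ℤ) (u : Fock) : Hop n u = quad (hopCoeff n) u := by
  obtain ⟨N, hN⟩ := band_hopCoeff n
  funext μ
  unfold Hop quad
  rw [mul_finsum, finsum_curry]
  · refine finsum_congr fun i => ?_
    rw [finsum_eq_single _ (-n - 1 - i)]
    · simp only [hopCoeff]
      rw [if_pos (by ring)]
      ring
    · intro j hj
      simp only [hopCoeff]
      rw [if_neg (fun h => hj (by omega)), zero_mul]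
  · refine (quadBox N μ).finite_toSet.subset fun p hp => ?_
    by_contra h
    exact hp (quad_support hN μ p h u)

/-- `H_n` as a linear map. -/
def HopL (n : ℤ) : Fock →ₗ[ℂ] Fock := quadL (hopCoeff n) (band_hopCoeff n)

theorem HopL_apply (n : ℤ) (u : Fock) : HopL n u = Hop n u := (Hop_eq_quad n u).symm

theorem isLocalOp_HopL (n : ℤ) : IsLocalOp (HopL n) := isLocalOp_quadL _

theorem neg_one_zpow_mul_self (j : ℤ) : (-1 : ℂ) ^ j * (-1 : ℂ) ^ j = 1 := by
  rw [← mul_zpow]; simp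

theorem neg_one_zpow_sub (i j : ℤ) : (-1 : ℂ) ^ (i - j) = (-1 : ℂ) ^ i * (-1 : ℂ) ^ j := by
  rw [zpow_sub₀ (by norm_num), div_eq_mul_inv, ← inv_zpow]
  norm_num

/-- For i = m - n the two summands carry the signs (-1)^i and (-1)^{-1-m}, which agree because n is
odd; for even n they would cancel. -/
theorem quadComm_hopCoeff {n : ℤ} (hn : Odd n) (i m : ℤ) :
    quadComm (hopCoeff n) i m = if i = m - n then 1 else 0 := by
  unfold quadComm hopCoeff
  by_cases h : i = m - n
  · rw [if_pos (by omega), if_pos (by omega), if_pos h, h, neg_one_zpow_sub, neg_one_zpow_sub,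
      hn.neg_one_zpow]
    have := neg_one_zpow_mul_self m
    linear_combination this
  · rw [if_neg (by omega), if_neg (by omega), if_neg h, add_zero, mul_zero]

theorem Fock.ext_local {u v : Fock} (h : ∀ κ : Fock →ₗ[ℂ] ℂ, IsLocal κ → κ u = κ v) : u = v := by
  ext μ
  exact h _ (isLocal_coeff μ)

theorem HopL_phi {n : ℤ} (hn : Odd n) (m : ℤ) (u : Fock) :
    HopL n (phi m u) = phi m (HopL n u) + phi (m - n) u := by
  refine Fock.ext_local fun κ hκ => ?_
  have h := hκ.quadL_phi (band_hopCoeff n) m u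
  rw [finsum_eq_single _ (m - n)] at h
  · rw [quadComm_hopCoeff hn, if_pos rfl, one_mul] at h
    rw [map_add, ← h]
    simp [HopL]
  · intro i hi
    rw [quadComm_hopCoeff hn, if_neg hi, zero_mul]

/-- The coefficients of the quadratic part of `rep a`. -/
def repCoeff (a : CInf) (i j : ℤ) : ℂ := (1 / 2 : ℂ) * (a.mat (i + 1) (-j) * (-1 : ℂ) ^ (-j - 1))

theorem band_repCoeff (a : CInf) : Band (repCoeff a) := by
  obtain ⟨N, hN⟩ := a.band
  refine ⟨N + 1, fun i j h => ?_⟩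
  rw [repCoeff, hN, zero_mul, mul_zero]
  rw [lt_abs] at h ⊢
  omega

/-- `rep a` as a linear map. -/
def repL (a : CInf) : Fock →ₗ[ℂ] Fock :=
  quadL (repCoeff a) (band_repCoeff a) - ((1 / 2 : ℂ) * a.central) • LinearMap.id

theorem coe_repL (a : CInf) : ⇑(repL a) = rep a := by
  funext u μ
  change (∑ᶠ p : ℤ × ℤ, repCoeff a p.1 p.2 * MvPowerSeries.coeff μ (nord p.1 p.2 u)) -
    ((1 / 2 : ℂ) * a.central) * MvPowerSeries.coeff μ u = _
  unfold rep
  rw [mul_finsum]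
  congr 1
  -- Passes from the matrix indices (i, j) to the Boson indices (i - 1, -j).
  rw [← finsum_comp_equiv ((Equiv.subRight (1 : ℤ)).prodCongr (Equiv.neg ℤ))]
  refine finsum_congr fun p => ?_
  simp [repCoeff, mul_assoc]

theorem isLocalOp_repL (a : CInf) : IsLocalOp (repL a) :=
  (isLocalOp_quadL _).sub (isLocalOp_id.smul _)

theorem hasQuadComm_repL (a : CInf) : HasQuadComm (repL a) (repCoeff a) := fun κ hκ m u => by
  rw [← hκ.quadL_phi (band_repCoeff a) m u]
  simp [repL]

/-! ### The bilinear form `∑_j (-1)^j φ_j ⊗ φ_{-1-j}` -/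

/-- The pairing of `∑_j (-1)^j φ_j v ⊗ φ_{-1-j} w` with `κ ⊗ κ'`. -/
def pairing (κ κ' : Fock →ₗ[ℂ] ℂ) (v w : Fock) : ℂ :=
  ∑ᶠ j : ℤ, (-1 : ℂ) ^ j * (κ (phi j v) * κ' (phi (-1 - j) w))

theorem exists_pairing_index {κ κ' : Fock →ₗ[ℂ] ℂ} (h : IsLocal κ) (h' : IsLocal κ') (n : ℤ) :
    ∃ J : Finset ℤ, ∀ j ∉ J, ∀ v w, κ (phi j v) * κ' (phi (n - j) w) = 0 := by
  obtain ⟨M, hM⟩ := h.exists_phi_eq_zero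
  obtain ⟨M', hM'⟩ := h'.exists_phi_eq_zero
  refine ⟨Finset.Icc (n - M') M, fun j hj v w => ?_⟩
  rw [Finset.mem_Icc, not_and_or, not_le, not_le] at hj
  rcases hj with hj | hj
  · rw [hM' _ (by omega), mul_zero]
  · rw [hM _ (by omega), zero_mul]

theorem exists_pairing_eq_sum {κ κ' : Fock →ₗ[ℂ] ℂ} (h : IsLocal κ) (h' : IsLocal κ') :
    ∃ J : Finset ℤ, ∀ v w,
      pairing κ κ' v w = ∑ j ∈ J, (-1 : ℂ) ^ j * (κ (phi j v) * κ' (phi (-1 - j) w)) := by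
  obtain ⟨J, hJ⟩ := exists_pairing_index h h' (-1)
  refine ⟨J, fun v w => finsum_eq_sum_of_support_subset _ fun j hj => ?_⟩
  by_contra hj'
  exact hj (by simp only [hJ j hj' v w, mul_zero])

theorem hasFiniteSupport_pairing {κ κ' : Fock →ₗ[ℂ] ℂ} (h : IsLocal κ) (h' : IsLocal κ')
    (n : ℤ) (c : ℤ → ℂ) (v w : Fock) :
    Function.HasFiniteSupport fun j : ℤ => c j * (κ (phi j v) * κ' (phi (n - j) w)) := by
  obtain ⟨J, hJ⟩ := exists_pairing_index h h' n
  refine J.finite_toSet.subset fun j hj => ?_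
  by_contra hj'
  exact hj (by simp only [hJ j hj' v w, mul_zero])

/-- Both commutator terms are sums of the same kernel b_{ij} + b_{ji} against κ(φ_i v) κ'(φ_j w).
They enter with opposite signs because (-1)^j and (-1)^{-1-j} are opposite; the symmetry of the
kernel makes them cancel. -/
theorem pairing_quadComm {T : Fock →ₗ[ℂ] Fock} (hTl : IsLocalOp T) {b : ℤ → ℤ → ℂ} (hb : Band b)
    (hT : HasQuadComm T b) {κ κ' : Fock →ₗ[ℂ] ℂ} (h : IsLocal κ) (h' : IsLocal κ') (v w : Fock) :
    pairing (κ ∘ₗ T) κ' v w + pairing κ (κ' ∘ₗ T) v w =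
      pairing κ κ' (T v) w + pairing κ κ' v (T w) := by
  have hK : Function.HasFiniteSupport fun p : ℤ × ℤ =>
      (b p.1 p.2 + b p.2 p.1) * (κ (phi p.1 v) * κ' (phi p.2 w)) := by
    obtain ⟨N, hN⟩ := hb
    obtain ⟨M, hM⟩ := h.exists_phi_eq_zero
    obtain ⟨M', hM'⟩ := h'.exists_phi_eq_zero
    refine ((Set.finite_Icc (-N - M') M).prod (Set.finite_Icc (-N - M) M')).subset fun p hp => ?_
    by_contra hp'
    refine hp ?_
    by_cases h1 : M ≤ p.1
    · simp only [hM _ h1, zero_mul, mul_zero]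
    by_cases h2 : M' ≤ p.2
    · simp only [hM' _ h2, mul_zero]
    have h3 : N < |p.1 + p.2| := by
      by_contra h3
      rw [not_lt, abs_le] at h3
      exact hp' (by simp only [Set.mem_prod, Set.mem_Icc]; omega)
    simp only [hN _ _ h3, hN p.2 p.1 (by rwa [add_comm]), add_zero, zero_mul]
  have e1 : pairing (κ ∘ₗ T) κ' v w - pairing κ κ' (T v) w =
      ∑ᶠ p : ℤ × ℤ, (b p.1 p.2 + b p.2 p.1) * (κ (phi p.1 v) * κ' (phi p.2 w)) := by
    unfold pairing
    rw [← finsum_sub_distrib (hasFiniteSupport_pairing (h.comp hTl) h' (-1) _ v w)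
        (hasFiniteSupport_pairing h h' (-1) _ (T v) w),
      ← finsum_comp_equiv ((Equiv.prodComm ℤ ℤ).trans
        ((Equiv.refl ℤ).prodCongr (Equiv.subLeft (-1 : ℤ)))), finsum_curry]
    · refine finsum_congr fun j => ?_
      rw [LinearMap.comp_apply, ← mul_sub, ← sub_mul, hT κ h, finsum_mul, mul_finsum]
      refine finsum_congr fun i => ?_
      simp only [quadComm, Equiv.trans_apply, Equiv.prodComm_apply, Prod.swap_prod_mk,
        Equiv.prodCongr_apply, Prod.map_apply, Equiv.refl_apply, Equiv.subLeft_apply]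
      have := neg_one_zpow_mul_self j
      linear_combination (b i (-1 - j) + b (-1 - j) i) * (κ (phi i v) * κ' (phi (-1 - j) w)) * this
    · exact hK.preimage (Equiv.injective _).injOn
  have e2 : pairing κ (κ' ∘ₗ T) v w - pairing κ κ' v (T w) =
      -∑ᶠ p : ℤ × ℤ, (b p.1 p.2 + b p.2 p.1) * (κ (phi p.1 v) * κ' (phi p.2 w)) := by
    unfold pairing
    rw [← finsum_sub_distrib (hasFiniteSupport_pairing h (h'.comp hTl) (-1) _ v w)
        (hasFiniteSupport_pairing h h' (-1) _ v (T w)), finsum_curry _ hK, ← finsum_neg_distrib]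
    refine finsum_congr fun j => ?_
    rw [LinearMap.comp_apply, ← mul_sub, ← mul_sub, hT κ' h', mul_finsum, mul_finsum,
      ← finsum_neg_distrib]
    refine finsum_congr fun i => ?_
    simp only [quadComm]
    rw [show (-1 : ℤ) - (-1 - j) = j by ring, neg_one_zpow_sub, zpow_neg_one, inv_neg_one]
    have := neg_one_zpow_mul_self j
    linear_combination -(b i j + b j i) * (κ (phi j v) * κ' (phi i w)) * this
  linear_combination e1 + e2

/-! ### Exponentials and the bilinear form -/

/-- κ is a finite combination of coefficients, each of which converges by assumption. -/
theorem IsLocal.hasSum_expOp {κ : Fock →ₗ[ℂ] ℂ} (h : IsLocal κ) {A : Fock → Fock} {u : Fock}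
    (hu : ExpDefined A u) :
    HasSum (fun n : ℕ => (n ! : ℂ)⁻¹ * κ (A^[n] u)) (κ (expOp A u)) := by
  obtain ⟨S, hS⟩ := h.exists_eq_sum
  have h1 : HasSum (fun n : ℕ => ∑ μ ∈ S, κ (MvPowerSeries.monomial μ 1) *
      ((n ! : ℂ)⁻¹ * MvPowerSeries.coeff μ (A^[n] u)))
      (∑ μ ∈ S, κ (MvPowerSeries.monomial μ 1) * MvPowerSeries.coeff μ (expOp A u)) :=
    hasSum_sum fun μ _ => (hu μ).hasSum.mul_left _
  rw [hS (expOp A u)]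
  refine h1.congr_fun fun n => ?_
  rw [hS (A^[n] u), Finset.mul_sum]
  exact Finset.sum_congr rfl fun _ _ => by ring

/-- The Cauchy product, legitimate since summability in ℂ is absolute. The binomial form matches the
powers of T ⊗ 1 + 1 ⊗ T. -/
theorem hasSum_exp_mul {a b : ℕ → ℂ} {A B : ℂ} (ha : HasSum (fun n : ℕ => (n ! : ℂ)⁻¹ * a n) A)
    (hb : HasSum (fun n : ℕ => (n ! : ℂ)⁻¹ * b n) B) :
    HasSum (fun N : ℕ => (N ! : ℂ)⁻¹ *
      ∑ p ∈ Finset.HasAntidiagonal.antidiagonal N, N.choose p.1 • (a p.1 * b p.2)) (A * B) := by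
  have h1 := tsum_mul_tsum_eq_tsum_sum_antidiagonal_of_summable_norm ha.summable.norm
    hb.summable.norm
  have h2 := (summable_norm_sum_mul_antidiagonal_of_summable_norm ha.summable.norm
    hb.summable.norm).of_norm.hasSum
  rw [← h1, ha.tsum_eq, hb.tsum_eq] at h2
  refine h2.congr_fun fun N => ?_
  rw [Finset.mul_sum]
  refine Finset.sum_congr rfl fun p hp => ?_
  have hN := Finset.HasAntidiagonal.mem_antidiagonal.1 hp
  have hc : (N.choose p.1 : ℂ) * (p.1 ! * p.2 !) = N ! := by
    rw [← hN, Nat.choose_symm_add, ← Nat.add_choose_mul_factorial_mul_factorial p.1 p.2]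
    push_cast
    ring
  have := Nat.cast_ne_zero (R := ℂ).2 (Nat.factorial_ne_zero N)
  have := Nat.cast_ne_zero (R := ℂ).2 (Nat.factorial_ne_zero p.1)
  have := Nat.cast_ne_zero (R := ℂ).2 (Nat.factorial_ne_zero p.2)
  rw [nsmul_eq_mul]
  field_simp
  linear_combination a p.1 * b p.2 * hc

section

variable {ι : Type} [Fintype ι]

/-- `∑_j (-1)^j φ_j v ⊗ φ_{-1-j} w = ∑_i x_i ⊗ y_i`. -/
def PairingEq (v w : Fock) (x y : ι → Fock) : Prop :=
  ∀ κ κ' : Fock →ₗ[ℂ] ℂ, IsLocal κ → IsLocal κ' → pairing κ κ' v w = ∑ i, κ (x i) * κ' (y i)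

/-- Applies (T ⊗ 1 + 1 ⊗ T)^N to both sides. The functionals stay quantified in the induction
because the step replaces κ by κ ∘ T, or κ' by κ' ∘ T. -/
theorem PairingEq.iterate {T : Fock →ₗ[ℂ] Fock} (hTl : IsLocalOp T) {b : ℤ → ℤ → ℂ} (hb : Band b)
    (hT : HasQuadComm T b) {v w : Fock} {x y : ι → Fock} (h : PairingEq v w x y) (N : ℕ) :
    ∀ κ κ' : Fock →ₗ[ℂ] ℂ, IsLocal κ → IsLocal κ' →
      ∑ p ∈ Finset.HasAntidiagonal.antidiagonal N,
        N.choose p.1 • pairing κ κ' (T^[p.1] v) (T^[p.2] w) =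
      ∑ p ∈ Finset.HasAntidiagonal.antidiagonal N, N.choose p.1 •
        ∑ i, κ (T^[p.1] (x i)) * κ' (T^[p.2] (y i)) := by
  induction N with
  | zero => intro κ κ' hκ hκ'; simp [h κ κ' hκ hκ']
  | succ N ih =>
    -- Pascal's rule: one factor T ⊗ 1 + 1 ⊗ T is split off.
    have key : ∀ f : ℕ → ℕ → ℂ, ∑ p ∈ Finset.HasAntidiagonal.antidiagonal (N + 1),
        (N + 1).choose p.1 • f p.1 p.2 =
        ∑ p ∈ Finset.HasAntidiagonal.antidiagonal N,
          N.choose p.1 • (f (p.1 + 1) p.2 + f p.1 (p.2 + 1)) := by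
      intro f
      rw [Finset.sum_antidiagonal_choose_succ_nsmul, ← Finset.sum_add_distrib]
      refine Finset.sum_congr rfl fun p hp => ?_
      have hN := Finset.HasAntidiagonal.mem_antidiagonal.1 hp
      rw [← Nat.choose_symm_of_eq_add hN.symm, ← smul_add, add_comm]
    intro κ κ' hκ hκ'
    rw [key fun m n => pairing κ κ' (T^[m] v) (T^[n] w),
      key fun m n => ∑ i, κ (T^[m] (x i)) * κ' (T^[n] (y i))]
    have h1 := ih (κ ∘ₗ T) κ' (hκ.comp hTl) hκ'
    have h2 := ih κ (κ' ∘ₗ T) hκ (hκ'.comp hTl)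
    simp only [Function.iterate_succ_apply', ← pairing_quadComm hTl hb hT hκ hκ', smul_add,
      Finset.sum_add_distrib, h1, h2, LinearMap.comp_apply]

/-- The N-th terms of the two exponential series agree by `PairingEq.iterate`, so their sums do. -/
theorem PairingEq.exp {T : Fock →ₗ[ℂ] Fock} (hTl : IsLocalOp T) {b : ℤ → ℤ → ℂ} (hb : Band b)
    (hT : HasQuadComm T b) {v w : Fock} {x y : ι → Fock} (h : PairingEq v w x y)
    (hv : ExpDefined T v) (hw : ExpDefined T w) (hx : ∀ i, ExpDefined T (x i))
    (hy : ∀ i, ExpDefined T (y i)) :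
    PairingEq (expOp T v) (expOp T w) (fun i => expOp T (x i)) (fun i => expOp T (y i)) := by
  intro κ κ' hκ hκ'
  obtain ⟨J, hJ⟩ := exists_pairing_eq_sum hκ hκ'
  have h1 : HasSum (fun N : ℕ => (N ! : ℂ)⁻¹ * ∑ p ∈ Finset.HasAntidiagonal.antidiagonal N,
      N.choose p.1 • pairing κ κ' (T^[p.1] v) (T^[p.2] w))
      (pairing κ κ' (expOp T v) (expOp T w)) := by
    rw [hJ]
    refine (hasSum_sum fun j _ => (hasSum_exp_mul
      ((hκ.comp (isLocalOp_phi j)).hasSum_expOp hv)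
      ((hκ'.comp (isLocalOp_phi (-1 - j))).hasSum_expOp hw)).mul_left ((-1 : ℂ) ^ j)).congr_fun
      fun N => ?_
    simp only [hJ, Finset.smul_sum, Finset.mul_sum]
    rw [Finset.sum_comm]
    refine Finset.sum_congr rfl fun j _ => Finset.sum_congr rfl fun p _ => ?_
    simp only [LinearMap.comp_apply, nsmul_eq_mul]
    ring
  have h2 : HasSum (fun N : ℕ => (N ! : ℂ)⁻¹ * ∑ p ∈ Finset.HasAntidiagonal.antidiagonal N,
      N.choose p.1 • ∑ i, κ (T^[p.1] (x i)) * κ' (T^[p.2] (y i)))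
      (∑ i, κ (expOp T (x i)) * κ' (expOp T (y i))) := by
    refine (hasSum_sum fun i _ => hasSum_exp_mul (hκ.hasSum_expOp (hx i))
      (hκ'.hasSum_expOp (hy i))).congr_fun fun N => ?_
    simp only [Finset.smul_sum, Finset.mul_sum]
    rw [Finset.sum_comm]
  simp only [h.iterate hTl hb hT _ κ κ' hκ hκ'] at h1
  exact h1.unique h2

theorem PairingEq.act {g : List CInf} {v w : Fock} {x y : ι → Fock} (h : PairingEq v w x y)
    (hv : InDom g v) (hw : InDom g w) (hx : ∀ i, InDom g (x i)) (hy : ∀ i, InDom g (y i)) :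
    PairingEq (act g v) (act g w) (fun i => act g (x i)) (fun i => act g (y i)) := by
  induction g with
  | nil => exact h
  | cons a g ih =>
    have := (ih hv.1 hw.1 (fun i => (hx i).1) fun i => (hy i).1).exp (isLocalOp_repL a)
      (band_repCoeff a) (hasQuadComm_repL a)
    rw [coe_repL] at this
    exact this hv.2 hw.2 (fun i => (hx i).2) fun i => (hy i).2

end

/-! ### The bilinear form at the vacuum -/

theorem IsLocal.hasSum {ι : Type*} {κ : Fock →ₗ[ℂ] ℂ} (h : IsLocal κ) {x : ι → Fock} {u : Fock}
    (hx : ∀ μ, HasSum (fun i => MvPowerSeries.coeff μ (x i)) (MvPowerSeries.coeff μ u)) :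
    HasSum (fun i => κ (x i)) (κ u) := by
  obtain ⟨S, hS⟩ := h.exists_eq_sum
  simp only [fun i => hS (x i), hS u]
  exact hasSum_sum fun μ _ => (hx μ).mul_left _

theorem IsLocal.lin {κ : Fock →ₗ[ℂ] ℂ} (h : IsLocal κ) :
    ∃ M₀ : ℕ, ∀ M ≥ M₀, (∀ m : ℕ, M ≤ m → ∀ u, κ (phi m u) = 0) ∧
      ∀ d, κ (lin d) = ∑ l ∈ Finset.range M, d (l + 1) * κ (phi l vac) := by
  obtain ⟨S, hS⟩ := h
  have hb : ∀ μ ∈ S, ∀ m : ℕ, S.sup varBound ≤ m → ∀ u,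
      MvPowerSeries.coeff μ (phi m u) = 0 := by
    intro μ hμ m hm u
    have : varBound μ ≤ S.sup varBound := Finset.le_sup hμ
    exact coeff_phi_eq_zero (by omega) u
  refine ⟨S.sup varBound, fun M hM => ⟨fun m hm u => hS _ fun μ hμ => hb μ hμ m (by omega) u,
    fun d => ?_⟩⟩
  have h0 : κ (CKP.lin d - ∑ l ∈ Finset.range M, d (l + 1) • phi l vac) = 0 := by
    refine hS _ fun μ hμ => ?_
    rw [map_sub, sub_eq_zero, map_sum]
    change (∑ᶠ l : ℕ, d (l + 1) * MvPowerSeries.coeff μ (phi l vac)) = _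
    rw [finsum_eq_sum_of_support_subset (s := Finset.range M)]
    · simp
    · intro l hl
      by_contra hl'
      rw [Finset.coe_range, Set.mem_Iio, not_lt] at hl'
      exact hl (by simp only [hb μ hμ l (hM.trans hl') vac, mul_zero])
  rw [map_sub, sub_eq_zero, map_sum] at h0
  simpa using h0

theorem phi_phi_phi_vac (m : ℕ) (a b : ℤ) :
    phi (-1 - m) (phi a (phi b vac)) = (-1 : ℂ) ^ m •
      ((if b = m then phi a vac else 0) + if a = m then phi b vac else 0) := by
  rw [phi_phi (-1 - m) a, phi_phi (-1 - m) b, phi_neg_vac (-1 - m) (by omega), map_zero, zero_add,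
    map_smul]
  by_cases h1 : b = m <;> by_cases h2 : a = m
  · subst h1; subst h2; simp
  · rw [if_pos (by omega), if_neg (by omega), if_pos h1, if_neg h2, h1]; simp
  · rw [if_neg (by omega), if_pos (by omega), if_neg h1, if_pos h2, h2]; simp
  · rw [if_neg (by omega), if_neg (by omega), if_neg h1, if_neg h2]; simp

/-- The annihilator φ_{-1-m} contracts with either Boson of each term of u, leaving (-1)^m ∑_l
(f_{l,m+1} + f_{m+1,l}) φ_{l-1}|0⟩ in integer indexing. -/
theorem hasSum_phi_phi_vac {κ : Fock →ₗ[ℂ] ℂ} (hκ : IsLocal κ) {f : ℤ → ℤ → ℂ} {u : Fock}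
    (hu : ∀ μ : ℕ →₀ ℕ, HasSum (fun p : ℤ × ℤ => f p.1 p.2 *
        MvPowerSeries.coeff μ (phi (p.1 - 1) (phi (p.2 - 1) vac))) (MvPowerSeries.coeff μ u))
    {d e : ℕ → ℂ} (hf : ∀ l j : ℕ, 1 ≤ l → 1 ≤ j → f l j + f j l = -(d l * e j + e l * d j))
    (m : ℕ) :
    κ (phi (-1 - m) u) =
      -((-1 : ℂ) ^ m * (κ (lin d) * e (m + 1) + κ (lin e) * d (m + 1))) := by
  obtain ⟨M₀, hM₀⟩ := hκ.lin
  -- The cutoff must also exceed m, so that the contracted index lies in the range.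
  obtain ⟨hM, hlin⟩ := hM₀ (max M₀ (m + 1)) (le_max_left _ _)
  have hm : m ∈ Finset.range (max M₀ (m + 1)) := by simp
  set M := max M₀ (m + 1)
  have h1 : HasSum (fun p : ℤ × ℤ => (κ ∘ₗ phi (-1 - m))
      (f p.1 p.2 • phi (p.1 - 1) (phi (p.2 - 1) vac))) ((κ ∘ₗ phi (-1 - m)) u) :=
    (hκ.comp (isLocalOp_phi _)).hasSum fun μ => by simpa using hu μ
  have hinj : Function.Injective fun p : ℕ × ℕ => ((p.1 + 1 : ℤ), (p.2 + 1 : ℤ)) := by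
    rintro ⟨a, b⟩ ⟨a', b'⟩ h
    simp only [Prod.mk.injEq] at h ⊢
    omega
  -- Only pairs of creation operators matter: if either factor is an annihilator, the two Bosons
  -- give a multiple of |0⟩, which φ_{-1-m} kills.
  rw [← hinj.hasSum_iff] at h1
  · have h2 := h1.unique (hasSum_sum_of_ne_finset_zero
      (s := Finset.range M ×ˢ Finset.range M) ?_)
    · rw [LinearMap.comp_apply] at h2
      rw [h2]
      simp only [Function.comp_apply, LinearMap.comp_apply, map_smul, add_sub_cancel_right,
        phi_phi_phi_vac, map_add, smul_add, Finset.sum_add_distrib, Nat.cast_inj]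
      simp only [Finset.sum_product]
      rw [Finset.sum_comm (s := Finset.range M)
        (f := fun x y => _ • _ • κ (if x = m then _ else _))]
      simp only [apply_ite κ, map_zero, smul_eq_mul, mul_ite, mul_zero, Finset.sum_ite_eq',
        if_pos hm]
      simp only [hlin, Finset.sum_mul, ← Finset.sum_add_distrib, Finset.mul_sum,
        ← Finset.sum_neg_distrib]
      refine Finset.sum_congr rfl fun l _ => ?_
      have := hf (l + 1) (m + 1) (by omega) (by omega)
      push_cast at this
      linear_combination (-1 : ℂ) ^ m * κ (phi l vac) * this
    · rintro ⟨a, b⟩ hab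
      simp only [Finset.mem_product, Finset.mem_range, not_and_or, not_lt] at hab
      have hm' := Finset.mem_range.1 hm
      simp only [Function.comp_apply, LinearMap.comp_apply, map_smul, add_sub_cancel_right,
        phi_phi_phi_vac, map_add, Nat.cast_inj]
      rcases hab with h | h
      · rw [if_neg (show a ≠ m by omega)]
        simp [apply_ite κ, hM a h]
      · rw [if_neg (show b ≠ m by omega)]
        simp [apply_ite κ, hM b h]
  · rintro ⟨a, b⟩ hab
    have hab' : a - 1 < 0 ∨ b - 1 < 0 := by
      by_contra h
      rw [not_or, not_lt, not_lt] at h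
      exact hab ⟨((a - 1).toNat, (b - 1).toNat), by simp only [Prod.mk.injEq]; omega⟩
    simp only [LinearMap.comp_apply, map_smul, phi_phi_phi_vac]
    rcases hab' with h | h
    · rw [if_neg (show a - 1 ≠ m by omega), phi_neg_vac _ h]
      simp
    · rw [if_neg (show b - 1 ≠ m by omega), phi_neg_vac _ h]
      simp

/-- Terms with j ≥ 0 vanish because φ_{-1-j} kills the vacuum in the second slot. In those with j =
-1 - m, the sign (-1)^{-1-m} cancels the one in `hasSum_phi_phi_vac`. -/
theorem pairing_vac {κ κ' : Fock →ₗ[ℂ] ℂ} (hκ : IsLocal κ) (hκ' : IsLocal κ')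
    {f : ℤ → ℤ → ℂ} {u : Fock}
    (hu : ∀ μ : ℕ →₀ ℕ, HasSum (fun p : ℤ × ℤ => f p.1 p.2 *
        MvPowerSeries.coeff μ (phi (p.1 - 1) (phi (p.2 - 1) vac))) (MvPowerSeries.coeff μ u))
    {d e : ℕ → ℂ} (hf : ∀ l j : ℕ, 1 ≤ l → 1 ≤ j → f l j + f j l = -(d l * e j + e l * d j)) :
    pairing κ κ' u vac = κ (lin d) * κ' (lin e) + κ (lin e) * κ' (lin d) := by
  classical
  obtain ⟨M, hM₀⟩ := hκ'.lin
  obtain ⟨hM, hlin⟩ := hM₀ M le_rfl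
  unfold pairing
  rw [finsum_eq_sum_of_support_subset (s := (Finset.range M).image fun m : ℕ => (-1 - m : ℤ)),
    Finset.sum_image]
  · rw [hlin, hlin, Finset.mul_sum, Finset.mul_sum, ← Finset.sum_add_distrib]
    refine Finset.sum_congr rfl fun m _ => ?_
    rw [hasSum_phi_phi_vac hκ hu hf, neg_one_zpow_sub, zpow_neg_one, inv_neg_one,
      show -1 - (-1 - (m : ℤ)) = m by ring, zpow_natCast]
    have : (-1 : ℂ) ^ m * (-1) ^ m = 1 := by rw [← mul_pow]; simp
    linear_combination (κ (CKP.lin d) * e (m + 1) + κ (CKP.lin e) * d (m + 1)) *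
      κ' (phi m vac) * this
  · intro a _ b _ h
    simpa using h
  · intro j hj
    by_contra hj'
    refine hj ?_
    by_cases h : 0 ≤ j
    · simp only [phi_neg_vac (-1 - j) (by omega), map_zero, mul_zero]
    · obtain ⟨m, rfl⟩ : ∃ m : ℕ, j = -1 - m := ⟨(-1 - j).toNat, by omega⟩
      have hm : M ≤ m := by
        by_contra hm
        exact hj' (Finset.mem_coe.2 (Finset.mem_image.2 ⟨m, Finset.mem_range.2 (by omega), rfl⟩))
      simp only [show -1 - (-1 - (m : ℤ)) = m by ring, hM m hm, mul_zero]

theorem pairing_vac_vac (κ κ' : Fock →ₗ[ℂ] ℂ) : pairing κ κ' vac vac = 0 := by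
  unfold pairing
  refine finsum_eq_zero_of_forall_eq_zero fun j => ?_
  by_cases h : 0 ≤ j
  · rw [phi_neg_vac (-1 - j) (by omega), map_zero, mul_zero, mul_zero]
  · rw [phi_neg_vac j (by omega), map_zero, zero_mul, mul_zero]

/-! ### The bilinear identity for g|0⟩ -/

theorem inDom_vac {g : List CInf} (hg : InSp g) : InDom g vac := by
  simpa [vac] using hg 1

theorem pairing_act_vac {g : List CInf} (hg : InSp g) {κ κ' : Fock →ₗ[ℂ] ℂ} (hκ : IsLocal κ)
    (hκ' : IsLocal κ') : pairing κ κ' (act g vac) (act g vac) = 0 := by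
  -- The empty family encodes a zero right-hand side.
  have h : PairingEq vac vac (Fin.elim0 : Fin 0 → Fock) Fin.elim0 := fun κ κ' _ _ => by
    rw [pairing_vac_vac]
    simp
  have := h.act (inDom_vac hg) (inDom_vac hg) (fun i => i.elim0) (fun i => i.elim0) κ κ' hκ hκ'
  rw [this]
  simp

/-- From φ_j H_k = H_k φ_j - φ_{j-k}. With i = j - k, the minus sign turns (-1)^j into
(-1)^{-k-1-i}, the sign produced by φ(-z) in the residue. -/
theorem pairing_HopL {k : ℤ} (hk : Odd k) {κ κ' : Fock →ₗ[ℂ] ℂ} (hκ : IsLocal κ)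
    (hκ' : IsLocal κ') (v w : Fock) :
    pairing κ κ' (HopL k v) w = pairing (κ ∘ₗ HopL k) κ' v w +
      ∑ᶠ i : ℤ, (-1 : ℂ) ^ (-k - 1 - i) * (κ (phi i v) * κ' (phi (-k - 1 - i) w)) := by
  have h1 : ∀ j : ℤ, (-1 : ℂ) ^ j * (κ (phi j (HopL k v)) * κ' (phi (-1 - j) w)) =
      (-1 : ℂ) ^ j * ((κ ∘ₗ HopL k) (phi j v) * κ' (phi (-1 - j) w)) +
      (-1 : ℂ) ^ (-k - 1 - (j - k)) * (κ (phi (j - k) v) * κ' (phi (-k - 1 - (j - k)) w)) := by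
    intro j
    rw [LinearMap.comp_apply, HopL_phi hk, map_add, show -k - 1 - (j - k) = -1 - j by ring,
      neg_one_zpow_sub, zpow_neg_one, inv_neg_one]
    ring
  unfold pairing
  simp only [h1]
  rw [finsum_add_distrib (hasFiniteSupport_pairing (hκ.comp (isLocalOp_HopL k)) hκ' (-1) _ v w)]
  · congr 1
    exact finsum_comp_equiv (Equiv.subRight k) (f := fun i : ℤ =>
      (-1 : ℂ) ^ (-k - 1 - i) * (κ (phi i v) * κ' (phi (-k - 1 - i) w)))
  · exact (hasFiniteSupport_pairing hκ hκ' (-k - 1) (fun i => (-1 : ℂ) ^ (-k - 1 - i)) v w).preimage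
      (Equiv.subRight k).injective.injOn

theorem bilinear_act_vac {k : ℕ} (hk : Odd k) {g : List CInf} (hg : InSp g)
    {f : ℤ → ℤ → ℂ} (hconj : ConjEq g k f) {d e : ℕ → ℂ}
    (hf : ∀ l j : ℕ, 1 ≤ l → 1 ≤ j → f l j + f j l = -(d l * e j + e l * d j))
    (hd : InDom g (lin d)) (he : InDom g (lin e))
    {κ κ' : Fock →ₗ[ℂ] ℂ} (hκ : IsLocal κ) (hκ' : IsLocal κ') :
    ∑ᶠ i : ℤ, (-1 : ℂ) ^ (-(k : ℤ) - 1 - i) *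
        (κ (phi i (act g vac)) * κ' (phi (-(k : ℤ) - 1 - i) (act g vac))) =
      κ (act g (lin d)) * κ' (act g (lin e)) + κ (act g (lin e)) * κ' (act g (lin d)) := by
  obtain ⟨u, hu, hug, hH⟩ := hconj 1
  simp only [MvPolynomial.coe_one] at hu hH
  have hk' : Odd (k : ℤ) := by exact_mod_cast hk
  have h1 : PairingEq u vac ![lin d, lin e] ![lin e, lin d] := fun κ κ' hκ hκ' => by
    rw [pairing_vac hκ hκ' hu hf]
    simp
  have h2 := h1.act hug (inDom_vac hg) (by simp [Fin.forall_fin_two, hd, he])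
    (by simp [Fin.forall_fin_two, hd, he]) κ κ' hκ hκ'
  have h3 := pairing_HopL hk' hκ hκ' (act g vac) (act g vac)
  rw [pairing_act_vac hg (hκ.comp (isLocalOp_HopL _)) hκ', zero_add] at h3
  rw [← h3, HopL_apply, show act g vac = act g 1 from rfl, hH]
  refine h2.trans ?_
  simp

/-! ### Exponentials of series of commuting operators -/

/-- The chain rule for powers, when the derivative S' of S commutes with S. It serves for the Euler
operator in z and for the time derivatives of e^{H(t)} and e^ξ. -/
theorem pow_succ_apply_of_commutator {V : Type} [AddCommGroup V] [Module ℂ V]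
    {D S S' : V →ₗ[ℂ] V} (h : ∀ x, D (S x) = S' x + S (D x)) (hc : ∀ x, S (S' x) = S' (S x))
    {x : V} (hx : D x = 0) (N : ℕ) :
    D (S^[N + 1] x) = ((N : ℂ) + 1) • S' (S^[N] x) := by
  induction N with
  | zero => simp [h, hx]
  | succ N ih =>
    rw [Function.iterate_succ_apply', h, ih, map_smul, hc, ← Function.iterate_succ_apply' S]
    push_cast
    module

theorem sum_antidiagonal_assoc {M : Type} [AddCommMonoid M] (F : ℕ → ℕ → ℕ → M) (n : ℕ) :
    ∑ p ∈ Finset.HasAntidiagonal.antidiagonal n,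
      ∑ q ∈ Finset.HasAntidiagonal.antidiagonal p.1, F q.1 q.2 p.2 =
    ∑ p ∈ Finset.HasAntidiagonal.antidiagonal n,
      ∑ q ∈ Finset.HasAntidiagonal.antidiagonal p.2, F p.1 q.1 q.2 := by
  simp only [Finset.sum_sigma']
  refine Finset.sum_nbij' (fun x => ⟨(x.2.1, x.2.2 + x.1.2), (x.2.2, x.1.2)⟩)
    (fun x => ⟨(x.1.1 + x.2.1, x.2.2), (x.1.1, x.2.1)⟩) ?_ ?_ ?_ ?_ ?_
  all_goals
    rintro ⟨⟨a, b⟩, ⟨c, d⟩⟩ h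
    simp only [Finset.mem_sigma, Finset.HasAntidiagonal.mem_antidiagonal] at h ⊢
  · exact ⟨by rw [← add_assoc, h.2, h.1], trivial⟩
  · exact ⟨by rw [add_assoc, h.2, h.1], trivial⟩
  · rw [h.2]
  · rw [h.2]

theorem sum_antidiagonal_left_comm {M : Type} [AddCommMonoid M] (F : ℕ → ℕ → ℕ → M) (n : ℕ) :
    ∑ p ∈ Finset.HasAntidiagonal.antidiagonal n,
      ∑ q ∈ Finset.HasAntidiagonal.antidiagonal p.2, F q.1 p.1 q.2 =
    ∑ p ∈ Finset.HasAntidiagonal.antidiagonal n,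
      ∑ q ∈ Finset.HasAntidiagonal.antidiagonal p.2, F p.1 q.1 q.2 := by
  rw [← sum_antidiagonal_assoc fun a b c => F b a c, ← sum_antidiagonal_assoc]
  exact Finset.sum_congr rfl fun p _ => Finset.Nat.sum_antidiagonal_swap
    (f := fun q => F q.1 q.2 p.2)

section

variable {M M' : Type} [AddCommGroup M] [Module ℂ M] [AddCommGroup M'] [Module ℂ M']

/-- `stepOp` of linear maps as a linear map. -/
def stepL (L : ℕ → M →ₗ[ℂ] M) : (ℕ → M) →ₗ[ℂ] (ℕ → M) where
  toFun := stepOp fun k => L k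
  map_add' U V := by
    funext b
    simp [stepOp, Finset.sum_add_distrib]
  map_smul' c U := by
    funext b
    simp [stepOp, Finset.smul_sum]

theorem stepL_apply (L : ℕ → M →ₗ[ℂ] M) (U : ℕ → M) (b : ℕ) :
    stepL L U b = ∑ k ∈ Finset.Icc 1 b, L k (U (b - k)) := rfl

/-- The Euler operator on series. -/
def eulerL : (ℕ → M) →ₗ[ℂ] (ℕ → M) where
  toFun U b := (b : ℂ) • U b
  map_add' U V := by
    funext b
    simp
  map_smul' c U := by
    funext b
    simp [smul_comm c]

theorem eulerL_stepL (L : ℕ → M →ₗ[ℂ] M) (U : ℕ → M) :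
    eulerL (stepL L U) = stepL (fun k => (k : ℂ) • L k) U + stepL L (eulerL U) := by
  funext b
  change (b : ℂ) • stepL L U b = stepL _ U b + stepL L (eulerL U) b
  simp only [stepL_apply, ← Finset.sum_add_distrib, Finset.smul_sum]
  refine Finset.sum_congr rfl fun k hk => ?_
  change _ = _ + L k (((b - k : ℕ) : ℂ) • U (b - k))
  rw [map_smul, LinearMap.smul_apply, ← add_smul, Nat.cast_sub (Finset.mem_Icc.1 hk).2]
  congr 1
  ring

theorem stepL_comm {L L' : ℕ → M →ₗ[ℂ] M} (h : ∀ k l x, L k (L' l x) = L' l (L k x))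
    (U : ℕ → M) : stepL L (stepL L' U) = stepL L' (stepL L U) := by
  funext b
  simp only [stepL_apply, map_sum]
  rw [Finset.sum_comm' (t' := Finset.Icc 1 b) (s' := fun l => Finset.Icc 1 (b - l))]
  · refine Finset.sum_congr rfl fun l _ => Finset.sum_congr rfl fun k _ => ?_
    rw [h, Nat.sub_right_comm]
  · intro k l
    simp only [Finset.mem_Icc]
    omega

theorem stepL_iterate_eq_zero (L : ℕ → M →ₗ[ℂ] M) (U : ℕ → M) {N b : ℕ} (hb : b < N) :
    ((stepL L)^[N] U) b = 0 := by
  induction N generalizing b with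
  | zero => omega
  | succ N ih =>
    rw [Function.iterate_succ_apply', stepL_apply]
    refine Finset.sum_eq_zero fun k hk => ?_
    have := Finset.mem_Icc.1 hk
    rw [ih (by omega), map_zero]

/-- `expCoeff` of linear maps as a linear map. -/
def expL (L : ℕ → M →ₗ[ℂ] M) (b : ℕ) : M →ₗ[ℂ] M :=
  ∑ N ∈ Finset.range (b + 1), ((N ! : ℂ)⁻¹) •
    (LinearMap.proj b ∘ₗ (stepL L ^ N) ∘ₗ LinearMap.single ℂ (fun _ => M) 0)

theorem expCoeff_eq (L : ℕ → M →ₗ[ℂ] M) (u : M) (b : ℕ) :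
    expCoeff (fun k => L k) u b = expL L b u := by
  simp only [expL, LinearMap.sum_apply, LinearMap.smul_apply, LinearMap.comp_apply,
    Module.End.pow_apply]
  rfl

theorem expL_apply (L : ℕ → M →ₗ[ℂ] M) (u : M) {b B : ℕ} (hB : b < B) :
    expL L b u = ∑ N ∈ Finset.range B, ((N ! : ℂ)⁻¹) • ((stepL L)^[N] (Pi.single 0 u)) b := by
  rw [← expCoeff_eq]
  refine Finset.sum_subset (Finset.range_mono hB) fun N _ hN => ?_
  rw [Finset.mem_range, not_lt] at hN
  rw [show (stepOp fun k => ⇑(L k)) = stepL L from rfl, stepL_iterate_eq_zero L _ (by omega),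
    smul_zero]

theorem expL_zero (L : ℕ → M →ₗ[ℂ] M) (u : M) : expL L 0 u = u := by
  simp [expL_apply L u (Nat.lt_succ_self 0)]

/-- This is z d/dz exp A = (z dA/dz) exp A in coefficients; commutativity lets the derivative of A
be moved to the front. -/
theorem smul_expL {L : ℕ → M →ₗ[ℂ] M} (h : ∀ k l x, L k (L l x) = L l (L k x)) (u : M) (b : ℕ) :
    (b : ℂ) • expL L b u =
      ∑ p ∈ Finset.HasAntidiagonal.antidiagonal b, (p.1 : ℂ) • L p.1 (expL L p.2 u) := by
  have hx : eulerL (Pi.single 0 u : ℕ → M) = 0 := by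
    funext c
    change (c : ℂ) • (Pi.single 0 u : ℕ → M) c = 0
    rcases c with _ | c <;> simp
  have key := pow_succ_apply_of_commutator (eulerL_stepL L)
    (stepL_comm (L := L) (L' := fun k => (k : ℂ) • L k) fun k l x => by simp [h k l]) hx
  -- A superfluous last term is kept, so that b + 1 terms remain after the one with N = 0 is split
  -- off.
  rw [expL_apply L u (show b < b + 1 + 1 by omega), Finset.sum_range_succ', smul_add,
    Finset.smul_sum]
  have h0 : (b : ℂ) • ((0 ! : ℂ)⁻¹) • ((stepL L)^[0] (Pi.single 0 u : ℕ → M)) b = 0 := by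
    rw [smul_comm]
    have := congrFun hx b
    change (b : ℂ) • (Pi.single 0 u : ℕ → M) b = 0 at this
    rw [Function.iterate_zero_apply, this, smul_zero]
  rw [h0, add_zero, Finset.Nat.sum_antidiagonal_eq_sum_range_succ
    (fun i j => (i : ℂ) • L i (expL L j u))]
  have h1 : ∀ N, (b : ℂ) • (((N + 1)! : ℂ)⁻¹) • ((stepL L)^[N + 1] (Pi.single 0 u : ℕ → M)) b =
      ∑ k ∈ Finset.range b.succ, (k : ℂ) • L k
        (((N ! : ℂ)⁻¹) • ((stepL L)^[N] (Pi.single 0 u : ℕ → M)) (b - k)) := by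
    intro N
    have h2 := congrFun (key N) b
    change (b : ℂ) • ((stepL L)^[N + 1] (Pi.single 0 u : ℕ → M)) b =
      ((N : ℂ) + 1) • stepL (fun k => (k : ℂ) • L k) _ b at h2
    rw [smul_comm, h2, stepL_apply, smul_smul, Finset.smul_sum, ← Finset.sum_subset (s₁ :=
      Finset.Icc 1 b) (s₂ := Finset.range b.succ)]
    · refine Finset.sum_congr rfl fun k _ => ?_
      rw [map_smul, LinearMap.smul_apply, smul_comm]
      congr 2
      rw [Nat.factorial_succ]
      have := Nat.cast_ne_zero (R := ℂ).2 (Nat.factorial_ne_zero N)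
      have := Nat.cast_ne_zero (R := ℂ).2 (Nat.succ_ne_zero N)
      push_cast at this ⊢
      field_simp
    · intro k hk
      simp only [Finset.mem_Icc, Finset.mem_range] at hk ⊢
      omega
    · intro k hk hk'
      simp only [Finset.mem_Icc, Finset.mem_range] at hk hk'
      obtain rfl : k = 0 := by omega
      simp
  simp only [h1]
  rw [Finset.sum_comm]
  refine Finset.sum_congr rfl fun k _ => ?_
  rw [expL_apply L u (show b - k < b + 1 by omega), map_sum, Finset.smul_sum]

/-- The term with p.1 = 0 vanishes, so for b > 0 the equation is a recursion with leading factor b,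
invertible in ℂ. -/
theorem expL_unique {L : ℕ → M →ₗ[ℂ] M} (h : ∀ k l x, L k (L l x) = L l (L k x)) {u : M}
    {C : ℕ → M} (h0 : C 0 = u)
    (hC : ∀ b : ℕ, (b : ℂ) • C b =
      ∑ p ∈ Finset.HasAntidiagonal.antidiagonal b, (p.1 : ℂ) • L p.1 (C p.2)) (b : ℕ) :
    C b = expL L b u := by
  induction b using Nat.strong_induction_on with
  | _ b ih =>
    rcases Nat.eq_zero_or_pos b with rfl | hb
    · rw [h0, expL_zero]
    · refine (IsUnit.smul_left_cancel (Nat.cast_ne_zero (R := ℂ).2 hb.ne').isUnit).1 ?_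
      rw [hC, smul_expL h]
      refine Finset.sum_congr rfl fun p hp => ?_
      have := Finset.HasAntidiagonal.mem_antidiagonal.1 hp
      rcases Nat.eq_zero_or_pos p.1 with h1 | h1
      · simp [h1]
      · rw [ih p.2 (by omega)]

theorem map_expL {L : ℕ → M →ₗ[ℂ] M} {L' : ℕ → M' →ₗ[ℂ] M'} (T : M →ₗ[ℂ] M')
    (h : ∀ k x, T (L k x) = L' k (T x)) (b : ℕ) (u : M) :
    T (expL L b u) = expL L' b (T u) := by
  have h1 : ∀ (N b : ℕ), T (((stepL L)^[N] (Pi.single 0 u)) b) =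
      ((stepL L')^[N] (Pi.single 0 (T u))) b := by
    intro N
    induction N with
    | zero => intro b; rcases b with _ | b <;> simp
    | succ N ih =>
      intro b
      simp only [Function.iterate_succ_apply', stepL_apply, map_sum, h, ih]
  rw [expL_apply L u (Nat.lt_succ_self b), expL_apply L' _ (Nat.lt_succ_self b), map_sum]
  simp only [map_smul, h1]

theorem map_expL_of_forall_eq_zero {L : ℕ → M →ₗ[ℂ] M} (T : M →ₗ[ℂ] M')
    (h : ∀ k x, T (L k x) = 0) (b : ℕ) (u : M) :
    T (expL L b u) = if b = 0 then T u else 0 := by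
  rw [map_expL (L' := fun _ => 0) T h]
  symm
  refine expL_unique (C := fun b => if b = 0 then T u else 0) (fun _ _ _ => rfl) (by simp)
    (fun b => ?_) b
  rcases b with _ | b <;> simp

/-- The coefficient form of exp(-A) exp(A) = 1: in positive degree the Euler operator gives two
contributions, which cancel by commutativity. -/
theorem sum_expL_neg {L : ℕ → M →ₗ[ℂ] M} (h : ∀ k l x, L k (L l x) = L l (L k x)) (u : M)
    (n : ℕ) :
    ∑ p ∈ Finset.HasAntidiagonal.antidiagonal n, expL (fun k => -L k) p.1 (expL L p.2 u) =
      if n = 0 then u else 0 := by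
  rcases Nat.eq_zero_or_pos n with rfl | hn
  · simp [expL_zero]
  rw [if_neg hn.ne']
  have hneg : ∀ k l x, (-L k) ((-L l) x) = (-L l) ((-L k) x) := fun k l x => by simp [h k l]
  have hcomm : ∀ k c x, L k (expL (fun k => -L k) c x) = expL (fun k => -L k) c (L k x) :=
    fun k c x => map_expL (L k) (fun l x => by simp [h k l]) c x
  refine (smul_eq_zero.1 ?_).resolve_left (Nat.cast_ne_zero (R := ℂ).2 hn.ne')
  rw [Finset.smul_sum]
  have h1 : ∀ p ∈ Finset.HasAntidiagonal.antidiagonal n,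
      (n : ℂ) • expL (fun k => -L k) p.1 (expL L p.2 u) =
      -(∑ q ∈ Finset.HasAntidiagonal.antidiagonal p.1,
        (q.1 : ℂ) • L q.1 (expL (fun k => -L k) q.2 (expL L p.2 u))) +
      ∑ q ∈ Finset.HasAntidiagonal.antidiagonal p.2,
        (q.1 : ℂ) • L q.1 (expL (fun k => -L k) p.1 (expL L q.2 u)) := by
    intro p hp
    have hn := Finset.HasAntidiagonal.mem_antidiagonal.1 hp
    rw [← hn, Nat.cast_add, add_smul, smul_expL hneg, ← map_smul, smul_expL h, map_sum,
      ← Finset.sum_neg_distrib]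
    simp only [map_smul, hcomm, LinearMap.neg_apply, smul_neg]
  rw [Finset.sum_congr rfl h1, Finset.sum_add_distrib, Finset.sum_neg_distrib,
    sum_antidiagonal_assoc fun k c m => (k : ℂ) • L k (expL (fun k => -L k) c (expL L m u)),
    ← sum_antidiagonal_left_comm fun k c m =>
      (k : ℂ) • L k (expL (fun k => -L k) c (expL L m u)), neg_add_cancel]

end

/-! ### The Heisenberg operators of positive index -/

/-- Creation operators generate all polynomials from the vacuum, and a local functional is
determined by its values on monomials. -/
theorem IsLocalOp.eq_zero_of_commute {T : Fock →ₗ[ℂ] Fock} (hT : IsLocalOp T)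
    (hc : ∀ (n : ℕ) (u : Fock), T (phi n u) = phi n (T u)) (hv : T vac = 0) : T = 0 := by
  have hp : ∀ p : MvPolynomial ℕ ℂ, T (p : Fock) = 0 := by
    intro p
    induction p using MvPolynomial.induction_on with
    | C a =>
      have : ((MvPolynomial.C a : MvPolynomial ℕ ℂ) : Fock) = a • vac := by
        rw [MvPolynomial.coe_C, vac, MvPowerSeries.smul_eq_C_mul, mul_one]
      rw [this, map_smul, hv, smul_zero]
    | add p q hp hq => rw [MvPolynomial.coe_add, map_add, hp, hq, add_zero]
    | mul_X p n hp =>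
      have : ((p * MvPolynomial.X n : MvPolynomial ℕ ℂ) : Fock) = phi n (p : Fock) := by
        rw [MvPolynomial.coe_mul, MvPolynomial.coe_X, mul_comm]
        rfl
      rw [this, hc, hp, map_zero]
  refine LinearMap.ext fun u => Fock.ext_local fun κ hκ => ?_
  obtain ⟨S, hS⟩ := (hκ.comp hT).exists_eq_sum
  have h0 : ∀ μ, (κ ∘ₗ T) (MvPowerSeries.monomial μ 1) = 0 := fun μ => by
    rw [LinearMap.comp_apply, ← MvPolynomial.coe_monomial, hp, map_zero]
  rw [← LinearMap.comp_apply, hS u]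
  simp [h0]

theorem HopL_vac {n : ℤ} (hn : 0 < n) : HopL n vac = 0 := by
  refine Fock.ext_local fun κ hκ => ?_
  obtain ⟨B, hB⟩ := hκ.comp_quadL (band_hopCoeff n)
  rw [HopL, hB B subset_rfl, map_zero]
  refine Finset.sum_eq_zero fun p _ => ?_
  unfold hopCoeff
  split_ifs with h
  · have : nord p.1 p.2 vac = 0 := by
      rcases lt_or_ge p.2 0 with h2 | h2
      · simp [nord, phi_neg_vac _ h2, vev]
      · rw [nord_comm]
        simp [nord, phi_neg_vac p.1 (by omega), vev]
    rw [nordL_apply, this, map_zero, mul_zero]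
  · rw [zero_mul]

/-- The commutator commutes with every Boson, since both orders shift the index by m + n, and it
kills the vacuum. No infinite normally ordered products need to be multiplied. -/
theorem HopL_comm {m n : ℤ} (hm : Odd m) (hn : Odd n) (hm0 : 0 < m) (hn0 : 0 < n) (u : Fock) :
    HopL m (HopL n u) = HopL n (HopL m u) := by
  have h : HopL m ∘ₗ HopL n - HopL n ∘ₗ HopL m = 0 := by
    refine (((isLocalOp_HopL m).comp (isLocalOp_HopL n)).sub
      ((isLocalOp_HopL n).comp (isLocalOp_HopL m))).eq_zero_of_commute (fun j u => ?_) ?_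
    · simp only [LinearMap.sub_apply, LinearMap.comp_apply, HopL_phi hm, HopL_phi hn, map_add,
        map_sub]
      rw [show (j : ℤ) - n - m = j - m - n by ring]
      abel
    · simp [HopL_vac hm0, HopL_vac hn0]
  exact sub_eq_zero.1 (LinearMap.congr_fun h u)

/-- The operator `H_{2p+1}`. -/
def posH (p : ℕ) : Fock →ₗ[ℂ] Fock := HopL (2 * (p : ℤ) + 1)

theorem posH_comm (p q : ℕ) (u : Fock) : posH p (posH q u) = posH q (posH p u) :=
  HopL_comm ⟨p, rfl⟩ ⟨q, rfl⟩ (by omega) (by omega) u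

theorem posH_phi (p : ℕ) (j : ℤ) (u : Fock) :
    posH p (phi j u) = phi j (posH p u) + phi (j - (2 * p + 1)) u :=
  HopL_phi ⟨p, rfl⟩ j u

/-! ### The evolution `e^{H(t)}` -/

/-- `hStep` as a linear map. -/
def hStepL : ((ℕ →₀ ℕ) → Fock) →ₗ[ℂ] ((ℕ →₀ ℕ) → Fock) where
  toFun := hStep
  map_add' U V := by
    funext n
    simp [hStep, ← HopL_apply, Finset.sum_add_distrib]
  map_smul' c U := by
    funext n
    simp [hStep, ← HopL_apply, Finset.smul_sum]

theorem hStepL_apply (U : (ℕ →₀ ℕ) → Fock) (n : ℕ →₀ ℕ) :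
    hStepL U n = ∑ p ∈ n.support, posH p (U (n - Finsupp.single p 1)) :=
  Finset.sum_congr rfl fun _ _ => (HopL_apply _ _).symm

/-- The derivative in `t_{2p+1}` of a series with coefficients in the completed Fock space. -/
def timeDeriv (p : ℕ) : ((ℕ →₀ ℕ) → Fock) →ₗ[ℂ] ((ℕ →₀ ℕ) → Fock) where
  toFun U n := ((n p : ℂ) + 1) • U (n + Finsupp.single p 1)
  map_add' U V := by
    funext n
    simp
  map_smul' c U := by
    funext n
    simp [smul_comm c]

/-- The operator `H_{2p+1}` on the coefficients of a series. -/
def coeffH (p : ℕ) : ((ℕ →₀ ℕ) → Fock) →ₗ[ℂ] ((ℕ →₀ ℕ) → Fock) where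
  toFun U n := posH p (U n)
  map_add' U V := by
    funext n
    simp
  map_smul' c U := by
    funext n
    simp

theorem timeDeriv_apply (p : ℕ) (U : (ℕ →₀ ℕ) → Fock) (n : ℕ →₀ ℕ) :
    timeDeriv p U n = ((n p : ℂ) + 1) • U (n + Finsupp.single p 1) := rfl

theorem coeffH_apply (p : ℕ) (U : (ℕ →₀ ℕ) → Fock) (n : ℕ →₀ ℕ) :
    coeffH p U n = posH p (U n) := rfl

theorem exponent_induction {P : (ℕ →₀ ℕ) → Prop} (h0 : P 0)
    (hs : ∀ n p, P n → P (n + Finsupp.single p 1)) (n : ℕ →₀ ℕ) : P n := by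
  have key : ∀ m, P m → P (m + n) := by
    induction n using Finsupp.induction_linear with
    | zero => exact fun m hm => by rwa [add_zero]
    | add f g hf hg =>
      intro m hm
      rw [← add_assoc]
      exact hg _ (hf _ hm)
    | single p k =>
      induction k with
      | zero => exact fun m hm => by rwa [Finsupp.single_zero, add_zero]
      | succ k ih =>
        intro m hm
        rw [Finsupp.single_add, ← add_assoc]
        exact hs _ _ (ih _ hm)
  simpa using key 0 h0

theorem timeDeriv_hStepL (p : ℕ) (U : (ℕ →₀ ℕ) → Fock) :
    timeDeriv p (hStepL U) = coeffH p U + hStepL (timeDeriv p U) := by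
  classical
  funext n
  rw [Pi.add_apply, timeDeriv_apply, coeffH_apply]
  have hs : (n + Finsupp.single p 1).support = insert p n.support := by
    ext q
    by_cases h : q = p
    · subst h; simp
    · simp [h]
  have h2 : hStepL (timeDeriv p U) n = ∑ q ∈ insert p n.support, if q ∈ n.support then
      posH q (timeDeriv p U (n - Finsupp.single q 1)) else 0 := by
    rw [hStepL_apply, ← Finset.sum_subset (Finset.subset_insert p n.support)]
    · exact Finset.sum_congr rfl fun q hq => by rw [if_pos hq]
    · exact fun q _ hq => if_neg hq
  have h3 : posH p (U n) = ∑ q ∈ insert p n.support, if q = p then posH p (U n) else 0 := by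
    rw [Finset.sum_ite_eq' _ _ fun _ => posH p (U n), if_pos (Finset.mem_insert_self _ _)]
  rw [h2, h3, hStepL_apply, hs, Finset.smul_sum, ← Finset.sum_add_distrib]
  refine Finset.sum_congr rfl fun q hq => ?_
  rw [timeDeriv_apply]
  -- For q = p the factor n_p + 1 splits: 1 gives the commutator term and n_p the derivative of U.
  by_cases hqp : q = p
  · subst hqp
    rw [if_pos rfl, add_tsub_cancel_right]
    by_cases hn : n q = 0
    · rw [if_neg (by simpa using hn), hn]
      simp
    · rw [if_pos (by simpa using hn), Finsupp.sub_add_single_one_cancel hn, map_smul]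
      have : (((n - Finsupp.single q 1 : ℕ →₀ ℕ) q : ℕ) : ℂ) + 1 = n q := by
        have h : (n - Finsupp.single q 1 : ℕ →₀ ℕ) q + 1 = n q := by
          simp only [Finsupp.coe_tsub, Pi.sub_apply, Finsupp.single_eq_same]
          omega
        exact_mod_cast h
      rw [this]
      module
  · have hqn : q ∈ n.support := (Finset.mem_insert.1 hq).resolve_left hqp
    have hle : Finsupp.single q 1 ≤ n := by
      rw [Finsupp.single_le_iff]
      have := Finsupp.mem_support_iff.1 hqn
      omega
    rw [if_neg hqp, if_pos hqn, zero_add, map_smul, tsub_add_eq_add_tsub hle]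
    congr 3
    simp [Ne.symm hqp]

theorem hStepL_coeffH (p : ℕ) (U : (ℕ →₀ ℕ) → Fock) :
    hStepL (coeffH p U) = coeffH p (hStepL U) := by
  funext n
  change hStepL (coeffH p U) n = posH p (hStepL U n)
  rw [hStepL_apply, hStepL_apply, map_sum]
  exact Finset.sum_congr rfl fun q _ => posH_comm q p _

/-- The equation ∂e^{H(t)}/∂t_{2p+1} = H_{2p+1} e^{H(t)}. Together with `expH_zero` it is all that
is used about the evolution later. -/
theorem smul_expH (u : Fock) (n : ℕ →₀ ℕ) (p : ℕ) :
    ((n p : ℂ) + 1) • expH u (n + Finsupp.single p 1) = posH p (expH u n) := by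
  classical
  have hx : timeDeriv p (Pi.single 0 u) = 0 := by
    funext m
    change ((m p : ℂ) + 1) • (Pi.single 0 u : (ℕ →₀ ℕ) → Fock) (m + Finsupp.single p 1) = 0
    rw [Pi.single_eq_of_ne, smul_zero]
    intro h
    have := DFunLike.congr_fun h p
    simp at this
  have key := pow_succ_apply_of_commutator (timeDeriv_hStepL p) (hStepL_coeffH p) hx
  have h0 : (Pi.single 0 u : (ℕ →₀ ℕ) → Fock) (n + Finsupp.single p 1) = 0 := by
    rw [Pi.single_eq_of_ne]
    intro h
    have := DFunLike.congr_fun h p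
    simp at this
  unfold expH
  change _ • ∑ N ∈ _, _ • (hStepL^[N] (Pi.single 0 u)) _ =
    posH p (∑ N ∈ _, _ • (hStepL^[N] (Pi.single 0 u)) n)
  rw [map_add, Finsupp.degree_single, Finset.sum_range_succ', Function.iterate_zero_apply, h0,
    smul_zero, add_zero, Finset.smul_sum, map_sum]
  refine Finset.sum_congr rfl fun N _ => ?_
  have h2 := congrFun (key N) n
  change ((n p : ℂ) + 1) • (hStepL^[N + 1] (Pi.single 0 u)) (n + Finsupp.single p 1) =
    ((N : ℂ) + 1) • posH p ((hStepL^[N] (Pi.single 0 u)) n) at h2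
  rw [smul_comm, h2, map_smul, smul_smul, Nat.factorial_succ]
  congr 1
  have := Nat.cast_ne_zero (R := ℂ).2 (Nat.factorial_ne_zero N)
  have := Nat.cast_ne_zero (R := ℂ).2 (Nat.succ_ne_zero N)
  push_cast at this ⊢
  field_simp

theorem expH_zero (u : Fock) : expH u 0 = u := by
  simp [expH]

theorem isLocalOp_posH (p : ℕ) : IsLocalOp (posH p) := isLocalOp_HopL _

/-- The coefficients of `e^{H(t)}` are local linear operators. -/
theorem exists_expHL (n : ℕ →₀ ℕ) : ∃ T : Fock →ₗ[ℂ] Fock, IsLocalOp T ∧ ∀ u, T u = expH u n := by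
  induction n using exponent_induction with
  | h0 => exact ⟨LinearMap.id, isLocalOp_id, fun u => (expH_zero u).symm⟩
  | hs n p ih =>
    obtain ⟨T, hT, hTu⟩ := ih
    refine ⟨((n p : ℂ) + 1)⁻¹ • (posH p ∘ₗ T), ((isLocalOp_posH p).comp hT).smul _, fun u => ?_⟩
    rw [LinearMap.smul_apply, LinearMap.comp_apply, hTu, ← smul_expH,
      inv_smul_smul₀ (Nat.cast_add_one_ne_zero _)]

/-- The series `κ (e^{H(t)} u)`, as a linear function of the functional `κ`. -/
def bra (u : Fock) : (Fock →ₗ[ℂ] ℂ) →ₗ[ℂ] Times where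
  toFun κ := fun n => κ (expH u n)
  map_add' _ _ := rfl
  map_smul' _ _ := rfl

theorem coeff_bra (u : Fock) (κ : Fock →ₗ[ℂ] ℂ) (n : ℕ →₀ ℕ) :
    MvPowerSeries.coeff n (bra u κ) = κ (expH u n) := rfl

theorem pderiv_bra (u : Fock) (κ : Fock →ₗ[ℂ] ℂ) (p : ℕ) :
    MvPowerSeries.pderiv ℂ p (bra u κ) = bra u (κ ∘ₗ posH p) := by
  ext n
  rw [MvPowerSeries.coeff_pderiv, coeff_bra, coeff_bra, LinearMap.comp_apply, ← smul_expH,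
    map_smul, smul_eq_mul, mul_comm]

/-! ### The operators `V_±` and the shift of the times -/

/-- The terms of the exponent of `V_+(z)`. -/
def plusL (k : ℕ) : Fock →ₗ[ℂ] Fock := if Odd k then (2 / (k : ℂ)) • HopL k else 0

/-- The terms of the exponent of `V_-(z)^{-1}`. -/
def minusL (k : ℕ) : Fock →ₗ[ℂ] Fock := if Odd k then (2 / (k : ℂ)) • HopL (-(k : ℤ)) else 0

/-- The terms of the exponent of the shift of the times. -/
def shiftL (k : ℕ) : Times →ₗ[ℂ] Times :=
  if Odd k then (2 / (k : ℂ)) • (MvPowerSeries.pderiv ℂ ((k - 1) / 2)).toLinearMap else 0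

/-- The terms of `ξ(t,z)`. -/
def xiL (k : ℕ) : Times →ₗ[ℂ] Times :=
  if Odd k then LinearMap.mulLeft ℂ (MvPowerSeries.X ((k - 1) / 2) : Times) else 0

theorem VplusInv_eq (b : ℕ) (u : Fock) : VplusInv b u = expL (fun k => -plusL k) b u := by
  rw [← expCoeff_eq]
  unfold VplusInv plusL
  congr 1
  funext k v
  split_ifs <;> simp [HopL_apply]

theorem VminusInv_eq (a : ℕ) (u : Fock) : VminusInv a u = expL minusL a u := by
  rw [← expCoeff_eq]
  unfold VminusInv minusL
  congr 1
  funext k v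
  split_ifs <;> simp [HopL_apply]

theorem shift_eq (F : Times) (b : ℕ) : shift F b = expL shiftL b F := by
  rw [← expCoeff_eq]
  unfold shift shiftL
  congr 1
  funext k v
  split_ifs <;> simp

theorem expXi_eq (a : ℕ) : expXi a = expL xiL a 1 := by
  rw [← expCoeff_eq]
  unfold expXi xiL
  congr 1
  funext k v
  split_ifs <;> simp

theorem HopL_eq_posH {k : ℕ} (hk : Odd k) : HopL k = posH ((k - 1) / 2) := by
  obtain ⟨m, rfl⟩ := hk
  rw [show (2 * m + 1 - 1) / 2 = m by omega, posH]
  push_cast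
  rfl

theorem plusL_comm (k l : ℕ) (u : Fock) : plusL k (plusL l u) = plusL l (plusL k u) := by
  unfold plusL
  split_ifs with hk hl
  · simp [HopL_eq_posH hk, HopL_eq_posH hl, posH_comm ((k - 1) / 2), smul_comm (2 / (k : ℂ))]
  all_goals simp

theorem pderiv_pderiv (p q : ℕ) (F : Times) :
    MvPowerSeries.pderiv ℂ p (MvPowerSeries.pderiv ℂ q F) =
      MvPowerSeries.pderiv ℂ q (MvPowerSeries.pderiv ℂ p F) := by
  ext n
  by_cases h : p = q
  · rw [h]
  · simp only [MvPowerSeries.coeff_pderiv]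
    rw [add_right_comm]
    simp [h, Ne.symm h]
    ring

theorem shiftL_comm (k l : ℕ) (F : Times) : shiftL k (shiftL l F) = shiftL l (shiftL k F) := by
  unfold shiftL
  split_ifs
  · simp [pderiv_pderiv ((k - 1) / 2), smul_comm (2 / (k : ℂ))]
  all_goals simp

theorem shiftL_bra (u : Fock) (κ : Fock →ₗ[ℂ] ℂ) (k : ℕ) :
    shiftL k (bra u κ) = bra u (κ ∘ₗ plusL k) := by
  unfold shiftL plusL
  split_ifs with hk
  · simp [pderiv_bra, HopL_eq_posH hk, LinearMap.comp_smul]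
  · simp

/-- Each ∂/∂t_k brings down H_k in front of e^{H(t)}, so both sides satisfy the recursion of
`expL_unique`. -/
theorem shift_bra (u : Fock) (κ : Fock →ₗ[ℂ] ℂ) (m : ℕ) :
    shift (bra u κ) m = bra u (κ ∘ₗ expL plusL m) := by
  rw [shift_eq]
  symm
  refine expL_unique (C := fun m => bra u (κ ∘ₗ expL plusL m)) shiftL_comm ?_ (fun b => ?_) m
  · congr 1
    ext v
    simp [expL_zero]
  · simp only [shiftL_bra, ← map_smul, ← map_sum]
    congr 1
    refine LinearMap.ext fun v => ?_
    simp only [LinearMap.smul_apply, LinearMap.comp_apply, LinearMap.sum_apply, ← map_smul,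
      smul_expL plusL_comm, map_sum]
    refine Finset.sum_congr rfl fun p _ => ?_
    simp only [map_smul, map_expL (plusL p.1) (fun l x => plusL_comm p.1 l x)]

/-! ### The series `e^{ξ(t,z)}` -/

/-- The coefficientwise derivative of a sequence of series in the times. -/
def seqDeriv (p : ℕ) : (ℕ → Times) →ₗ[ℂ] (ℕ → Times) where
  toFun U b := MvPowerSeries.pderiv ℂ p (U b)
  map_add' U V := by
    funext b
    simp
  map_smul' c U := by
    funext b
    simp

theorem pderiv_xiL (p k : ℕ) (F : Times) : MvPowerSeries.pderiv ℂ p (xiL k F) =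
    (if k = 2 * p + 1 then F else 0) + xiL k (MvPowerSeries.pderiv ℂ p F) := by
  unfold xiL
  split_ifs with hk hkp hkp
  · subst hkp
    rw [show (2 * p + 1 - 1) / 2 = p by omega]
    simp [Derivation.leibniz, add_comm]
  · obtain ⟨m, rfl⟩ := hk
    rw [show (2 * m + 1 - 1) / 2 = m by omega]
    have : p ≠ m := by omega
    simp [Derivation.leibniz, this.symm]
  · exact absurd ⟨p, hkp⟩ hk
  · simp

theorem pderiv_expXi (p a : ℕ) : MvPowerSeries.pderiv ℂ p (expXi a) =
    if 2 * p + 1 ≤ a then expXi (a - (2 * p + 1)) else 0 := by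
  set S' : ℕ → Times →ₗ[ℂ] Times := fun k => if k = 2 * p + 1 then LinearMap.id else 0 with hS'
  have h1 : ∀ U, seqDeriv p (stepL xiL U) = stepL S' U + stepL xiL (seqDeriv p U) := by
    intro U
    funext b
    rw [Pi.add_apply]
    change MvPowerSeries.pderiv ℂ p (stepL xiL U b) = _
    simp only [stepL_apply, map_sum, pderiv_xiL, Finset.sum_add_distrib]
    congr 1
    refine Finset.sum_congr rfl fun k _ => ?_
    simp only [hS']
    split_ifs <;> rfl
  have h2 : ∀ U, stepL xiL (stepL S' U) = stepL S' (stepL xiL U) := fun U =>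
    stepL_comm (fun k l x => by simp only [hS']; split_ifs <;> simp) U
  have h3 : seqDeriv p (Pi.single 0 1) = 0 := by
    funext b
    change MvPowerSeries.pderiv ℂ p ((Pi.single 0 1 : ℕ → Times) b) = 0
    rcases b with _ | b
    · simp
    · simp
  have key := pow_succ_apply_of_commutator h1 h2 h3
  have h4 : ∀ U : ℕ → Times, stepL S' U a = if 2 * p + 1 ≤ a then U (a - (2 * p + 1)) else 0 := by
    intro U
    rw [stepL_apply]
    split_ifs with h
    · rw [Finset.sum_eq_single (2 * p + 1)]
      · simp [hS']
      · intro k _ hk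
        simp [hS', hk]
      · intro hk
        exact absurd (Finset.mem_Icc.2 ⟨by omega, h⟩) hk
    · refine Finset.sum_eq_zero fun k hk => ?_
      have : k ≠ 2 * p + 1 := by
        have := Finset.mem_Icc.1 hk
        omega
      simp [hS', this]
  have h5 : ∀ N, MvPowerSeries.pderiv ℂ p (((N + 1)! : ℂ)⁻¹ •
      ((stepL xiL)^[N + 1] (Pi.single 0 1)) a) =
      if 2 * p + 1 ≤ a then (N ! : ℂ)⁻¹ • ((stepL xiL)^[N] (Pi.single 0 1)) (a - (2 * p + 1))
      else 0 := by
    intro N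
    have h6 := congrFun (key N) a
    rw [Pi.smul_apply, h4] at h6
    change MvPowerSeries.pderiv ℂ p (((stepL xiL)^[N + 1] (Pi.single 0 1)) a) = _ at h6
    rw [Derivation.map_smul, h6, smul_smul, smul_ite, smul_zero, Nat.factorial_succ]
    have : ((((N + 1) * N ! : ℕ) : ℂ)⁻¹ * ((N : ℂ) + 1)) = (N ! : ℂ)⁻¹ := by
      have := Nat.cast_ne_zero (R := ℂ).2 (Nat.factorial_ne_zero N)
      have := Nat.cast_ne_zero (R := ℂ).2 (Nat.succ_ne_zero N)
      push_cast at this ⊢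
      field_simp
    rw [this]
  rw [expXi_eq, expL_apply xiL 1 (show a < a + 1 + 1 by omega), Finset.sum_range_succ', map_add,
    map_sum]
  simp only [h5]
  have h7 : MvPowerSeries.pderiv ℂ p (((0 ! : ℂ)⁻¹) • ((stepL xiL)^[0] (Pi.single 0 1)) a) = 0 := by
    rw [Derivation.map_smul]
    have := congrFun h3 a
    change MvPowerSeries.pderiv ℂ p ((Pi.single 0 1 : ℕ → Times) a) = 0 at this
    rw [Function.iterate_zero_apply, this, smul_zero]
  rw [h7, add_zero]
  split_ifs with h
  · rw [expXi_eq, expL_apply xiL 1 (show a - (2 * p + 1) < a + 1 by omega)]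
  · simp

theorem coeff_zero_expXi (a : ℕ) :
    MvPowerSeries.coeff 0 (expXi a) = if a = 0 then (1 : ℂ) else 0 := by
  rw [expXi_eq, map_expL_of_forall_eq_zero]
  · simp
  · intro k F
    unfold xiL
    split_ifs <;> simp

/-- The weight of a monomial in the times for `deg t_k = k`. -/
def timeWeight : (ℕ →₀ ℕ) →+ ℕ := Finsupp.weight fun p : ℕ => 2 * p + 1

theorem timeWeight_single (p : ℕ) : timeWeight (Finsupp.single p 1) = 2 * p + 1 := by
  simp [timeWeight, Finsupp.weight_single]

/-- The coefficient of z^a in e^ξ is homogeneous of weight a for deg t_k = k; this makes sums over a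
finite. -/
theorem coeff_expXi_eq_zero (n : ℕ →₀ ℕ) :
    ∀ a, timeWeight n < a → MvPowerSeries.coeff n (expXi a) = 0 := by
  induction n using exponent_induction with
  | h0 => exact fun a ha => by rw [coeff_zero_expXi, if_neg (by omega)]
  | hs n p ih =>
    intro a ha
    rw [map_add, timeWeight_single] at ha
    have h := MvPowerSeries.coeff_pderiv (R := ℂ) (i := p) (expXi a) n
    rw [pderiv_expXi, if_pos (by omega), ih _ (by omega)] at h
    exact (mul_eq_zero.1 h.symm).resolve_right (Nat.cast_add_one_ne_zero _)

theorem coeff_expXi_mul_eq_zero {n : ℕ →₀ ℕ} {a : ℕ} (h : timeWeight n < a) (F : Times) :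
    MvPowerSeries.coeff n (expXi a * F) = 0 := by
  classical
  rw [MvPowerSeries.coeff_mul]
  refine Finset.sum_eq_zero fun p hp => ?_
  have := congrArg timeWeight (Finset.HasAntidiagonal.mem_antidiagonal.1 hp)
  rw [map_add] at this
  rw [coeff_expXi_eq_zero _ _ (by omega), zero_mul]

/-- `e^{H(t)} φ(z) = e^{ξ(t,z)} φ(z) e^{H(t)}`. -/
theorem coeff_bra_phi (u : Fock) (n : ℕ →₀ ℕ) : ∀ (κ : Fock →ₗ[ℂ] ℂ) (i : ℤ) (A : ℕ),
    timeWeight n < A → MvPowerSeries.coeff n (bra (phi i u) κ) =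
      ∑ a ∈ Finset.range A, MvPowerSeries.coeff n (expXi a * bra u (κ ∘ₗ phi (i - a))) := by
  induction n using exponent_induction with
  | h0 =>
    intro κ i A hA
    rw [coeff_bra, expH_zero, Finset.sum_eq_single 0]
    · rw [MvPowerSeries.coeff_zero_eq_constantCoeff_apply, map_mul,
        ← MvPowerSeries.coeff_zero_eq_constantCoeff_apply,
        ← MvPowerSeries.coeff_zero_eq_constantCoeff_apply, coeff_zero_expXi, if_pos rfl, coeff_bra,
        expH_zero, one_mul]
      simp
    · exact fun a _ ha => coeff_expXi_mul_eq_zero (by rw [map_zero]; omega) _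
    · exact fun h => absurd (Finset.mem_range.2 (by omega)) h
  | hs n p ih =>
    intro κ i A hA
    rw [map_add, timeWeight_single] at hA
    -- Comparing ∂/∂t_{2p+1} of both sides shifts the summation index by 2p + 1. The top 2p + 1
    -- terms of one sum vanish by weight, the bottom 2p + 1 of the other because ∂e^ξ = z^{2p+1}
    -- e^ξ.
    obtain ⟨B, rfl⟩ : ∃ B, A = B + (2 * p + 1) := ⟨A - (2 * p + 1), by omega⟩
    refine mul_right_cancel₀ (b := (n p : ℂ) + 1) (Nat.cast_add_one_ne_zero _) ?_
    rw [Finset.sum_mul, ← MvPowerSeries.coeff_pderiv, pderiv_bra,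
      ih _ i (B + (2 * p + 1)) (by omega)]
    simp only [← MvPowerSeries.coeff_pderiv, Derivation.leibniz, pderiv_bra, pderiv_expXi,
      smul_eq_mul, map_add, Finset.sum_add_distrib]
    have h1 : ∀ a : ℕ, bra u ((κ ∘ₗ posH p) ∘ₗ phi (i - a)) =
        bra u ((κ ∘ₗ phi (i - a)) ∘ₗ posH p) + bra u (κ ∘ₗ phi (i - a - (2 * p + 1))) := by
      intro a
      rw [← map_add]
      congr 1
      refine LinearMap.ext fun v => ?_
      simp [posH_phi]
    simp only [h1, mul_add, map_add, Finset.sum_add_distrib]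
    congr 1
    rw [Finset.sum_range_add, add_comm B, Finset.sum_range_add _ (2 * p + 1) B]
    have h2 : ∀ F : ℕ → Times, ∑ x ∈ Finset.range (2 * p + 1),
        MvPowerSeries.coeff n (expXi (B + x) * F x) = 0 := fun F =>
      Finset.sum_eq_zero fun x _ => coeff_expXi_mul_eq_zero (by omega) _
    rw [h2, add_zero]
    symm
    rw [Finset.sum_eq_zero (s := Finset.range (2 * p + 1)), zero_add]
    · refine Finset.sum_congr rfl fun x _ => ?_
      rw [if_pos (by omega), add_tsub_cancel_left, mul_comm, Nat.cast_add, ← sub_sub,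
        sub_right_comm]
      push_cast
      rfl
    · intro x hx
      rw [if_neg (by have := Finset.mem_range.1 hx; omega), mul_zero, map_zero]

/-! ### The operators of half-odd index on the left vacuum -/

/-- The functional `⟨0|φ_{-1/2}`. -/
def ell : Fock →ₗ[ℂ] ℂ := MvPowerSeries.coeff 0 ∘ₗ phi (-1)

theorem vev_eq (u : Fock) : vev u = MvPowerSeries.coeff 0 u := rfl

theorem ell_apply (u : Fock) : ell u = vev (phi (-1) u) := rfl

theorem ell_eq : ell = MvPowerSeries.coeff (Finsupp.single 0 1) := by
  refine LinearMap.ext fun u => ?_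
  change MvPowerSeries.coeff 0 (phi (Int.negSucc 0) u) = _
  simp only [phi, pow_zero, one_smul, Derivation.coeFn_coe]
  rw [MvPowerSeries.coeff_pderiv]
  simp

theorem isLocal_ell : IsLocal ell := (isLocal_coeff 0).comp (isLocalOp_phi _)

theorem ell_phi_zero (u : Fock) : ell (phi 0 u) = vev u := by
  rw [ell_apply, phi_phi, vev_eq, map_add, ← vev_eq, vev_phi 0 le_rfl]
  simp [vev_eq]

theorem varBound_zero : varBound 0 = 0 := by simp [varBound]

theorem varBound_single_zero : varBound (Finsupp.single 0 1) ≤ 1 := by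
  refine Finset.sup_le fun n hn => ?_
  have : n = 0 := by
    by_contra h
    exact Finsupp.mem_support_iff.1 hn (Finsupp.single_eq_of_ne h)
  omega

theorem ell_phi_pos {j : ℤ} (hj : 1 ≤ j) (u : Fock) : ell (phi j u) = 0 := by
  rw [ell_eq]
  have := varBound_single_zero
  exact coeff_phi_eq_zero (by omega) u

/-- The indices in H_{-k} add up to k - 1 ≥ 0. An index ≥ 1 would produce a variable not in μ, so
only k = 1 with φ_0 φ_0 is left. The hypotheses cover both ⟨0| and ⟨0|φ_{-1/2}. -/
theorem coeff_HopL_neg {μ : ℕ →₀ ℕ} (hb : varBound μ ≤ 1)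
    (h0 : ∀ u, MvPowerSeries.coeff μ (phi 0 (phi 0 u)) = 0) {k : ℤ} (hk : 0 < k) (u : Fock) :
    MvPowerSeries.coeff μ (HopL (-k) u) = 0 := by
  obtain ⟨B, hB⟩ := (isLocal_coeff μ).comp_quadL (band_hopCoeff (-k))
  rw [HopL, hB B subset_rfl]
  refine Finset.sum_eq_zero fun p _ => ?_
  unfold hopCoeff
  split_ifs with h
  · rw [nordL_apply]
    by_cases h1 : 1 ≤ p.1
    · rw [coeff_nord_eq_zero_left (by omega), mul_zero]
    by_cases h2 : 1 ≤ p.2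
    · rw [coeff_nord_eq_zero_right (by omega), mul_zero]
    rw [show p.1 = 0 by omega, show p.2 = 0 by omega, nord, vev_phi 0 le_rfl, zero_smul, sub_zero,
      h0, mul_zero]
  · rw [zero_mul]

theorem coeff_Hhalf {μ : ℕ →₀ ℕ} (hb : varBound μ ≤ 1)
    (h0 : ∀ u, MvPowerSeries.coeff μ (phi 0 (phi 0 u)) = 0) (i : ℕ) (u : Fock) :
    MvPowerSeries.coeff μ (Hhalf i u) =
      (1 / 2 : ℂ) * ∑ p ∈ Finset.HasAntidiagonal.antidiagonal i,
        MvPowerSeries.coeff μ (phi (-p.1) (expL (fun k => -plusL k) p.2 u)) := by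
  have hm : ∀ k v, MvPowerSeries.coeff μ (minusL k v) = 0 := by
    intro k v
    unfold minusL
    split_ifs with hk
    · rw [LinearMap.smul_apply, map_smul, coeff_HopL_neg hb h0 (by have := hk.pos; omega),
        smul_zero]
    · simp
  change (1 / 2 : ℂ) * ∑ᶠ p : ℕ × ℕ, MvPowerSeries.coeff μ
    (VminusInv p.1 (phi (-i - p.1 + p.2) (VplusInv p.2 u))) = _
  congr 1
  simp only [VminusInv_eq, VplusInv_eq, map_expL_of_forall_eq_zero (MvPowerSeries.coeff μ) hm]
  -- Only the constant term of V_-^{-1} survives, and φ_{b-i} with b > i creates a variable not in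
  -- μ.
  rw [finsum_eq_sum_of_support_subset (s := (Finset.HasAntidiagonal.antidiagonal i).image
    fun p => (0, p.2)), Finset.sum_image]
  · refine Finset.sum_congr rfl fun p hp => ?_
    have := Finset.HasAntidiagonal.mem_antidiagonal.1 hp
    rw [if_pos rfl]
    congr 3
    push_cast
    omega
  · intro p hp q hq h
    simp only [Prod.mk.injEq, true_and] at h
    have h1 := Finset.HasAntidiagonal.mem_antidiagonal.1 hp
    have h2 := Finset.HasAntidiagonal.mem_antidiagonal.1 hq
    ext <;> omega
  · rintro ⟨a, b⟩ hp
    by_contra hp'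
    refine hp ?_
    simp only
    split_ifs with ha
    · subst ha
      rw [coeff_phi_eq_zero]
      by_contra h
      exact hp' (Finset.mem_coe.2 (Finset.mem_image.2 ⟨(i - b, b),
        Finset.HasAntidiagonal.mem_antidiagonal.2 (by push_cast at h; omega), rfl⟩))
    · rfl

/-- The functional `4 ⟨0|H_{1/2} H_{i-1/2}`. -/
def gam (i : ℕ) : Fock →ₗ[ℂ] ℂ :=
  ∑ p ∈ Finset.HasAntidiagonal.antidiagonal i,
    ell ∘ₗ phi (-p.1) ∘ₗ expL (fun k => -plusL k) p.2

theorem vev_Hhalf_one (u : Fock) : vev (Hhalf 1 u) = (1 / 2 : ℂ) * ell u := by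
  have h := coeff_Hhalf (μ := 0) (by simp [varBound_zero])
    (fun u => vev_phi 0 le_rfl _) 1 u
  rw [Nat.cast_one] at h
  rw [vev_eq, h, Finset.Nat.sum_antidiagonal_succ]
  simp only [← vev_eq]
  simp [vev_phi 0 le_rfl, expL_zero, ell_apply]

theorem ell_Hhalf (i : ℕ) (u : Fock) : ell (Hhalf i u) = (1 / 2 : ℂ) * gam i u := by
  rw [ell_eq, coeff_Hhalf varBound_single_zero (fun u => by
    rw [← ell_eq, ell_phi_zero, vev_phi 0 le_rfl])]
  simp [gam, ell_eq]

theorem gam_zero (u : Fock) : gam 0 u = vev u := by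
  simp [gam, expL_zero, ell_phi_zero]

theorem vev_Hop_one (u : Fock) : vev (Hop 1 u) = (1 / 2 : ℂ) * ell (phi (-1) u) := by
  change -(1 / 2 : ℂ) * ∑ᶠ i : ℤ, (-1 : ℂ) ^ i * MvPowerSeries.coeff 0 (nord i (-1 - 1 - i) u) = _
  rw [finsum_eq_single _ (-1)]
  · rw [nord, show (-1 - 1 - -1 : ℤ) = -1 by norm_num, phi_neg_vac (-1) (by norm_num), map_zero,
      ell_apply, vev_eq, vev_eq, map_zero, zero_smul, sub_zero]
    simp
  · intro i hi
    rcases lt_or_ge i 0 with h | h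
    · rw [coeff_nord_eq_zero_right (by rw [varBound_zero]; push_cast; omega), mul_zero]
    · rw [coeff_nord_eq_zero_left (by rw [varBound_zero]; exact h), mul_zero]

/-- The two terms are -2⟨0|H_1 and ⟨0|φ_{-1/2}², which cancel. Hence no z^{-1} term appears in the
tau series. -/
theorem gam_one (u : Fock) : gam 1 u = 0 := by
  have h1 : expL (fun k => -plusL k) 1 u = -((2 : ℂ) • HopL 1 u) := by
    have h := smul_expL (L := fun k => -plusL k) (fun k l x => by simp [plusL_comm k l]) u 1
    rw [Finset.Nat.sum_antidiagonal_succ] at h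
    simpa [expL_zero, plusL] using h
  have h2 : gam 1 u = ell (phi 0 (expL (fun k => -plusL k) 1 u)) + ell (phi (-1) u) := by
    simp [gam, Finset.Nat.sum_antidiagonal_succ, expL_zero]
  rw [h2, h1, ell_phi_zero, vev_eq, map_neg, map_smul, ← vev_eq, HopL_apply, vev_Hop_one,
    smul_eq_mul]
  ring

/-- Multiplying by V_+(z) on the right cancels the V_+(z)^{-1} in the half-odd operators. -/
theorem sum_gam_comp (b : ℕ) (u : Fock) :
    ∑ p ∈ Finset.HasAntidiagonal.antidiagonal b, gam p.1 (expL plusL p.2 u) =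
      ell (phi (-b) u) := by
  simp only [gam, LinearMap.sum_apply, LinearMap.comp_apply]
  rw [sum_antidiagonal_assoc fun s c m =>
    ell (phi (-s) (expL (fun k => -plusL k) c (expL plusL m u)))]
  simp only [← map_sum, sum_expL_neg plusL_comm]
  rw [Finset.sum_eq_single (b, 0)]
  · simp
  · intro p hp hpb
    have := Finset.HasAntidiagonal.mem_antidiagonal.1 hp
    rw [if_neg, map_zero]
    intro h
    exact hpb (Prod.ext (by simp; omega) h)
  · intro h
    exact absurd (Finset.HasAntidiagonal.mem_antidiagonal.2 (add_zero b)) h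

/-! ### The wave series -/

theorem braOne_eq (u : Fock) : braOne u = (1 / 2 : ℂ) • bra u ell := by
  funext n
  exact vev_Hhalf_one _

theorem tauZero_eq (g : List CInf) : tauZero g = bra (act g vac) (gam 0) := by
  funext n
  exact (gam_zero _).symm

theorem tauPair_eq (g : List CInf) (i : ℕ) :
    tauPair g i = (1 / 4 : ℂ) • bra (act g vac) (gam i) := by
  funext n
  change vev (Hhalf 1 (Hhalf i (expH (act g vac) n))) = (1 / 4 : ℂ) * gam i (expH (act g vac) n)
  rw [vev_Hhalf_one, ell_Hhalf]
  ring

theorem tauShift_eq (g : List CInf) (b : ℕ) :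
    tauShift (tauZero g) (tauPair g) b = (1 / 2 : ℂ) • bra (act g vac) (ell ∘ₗ phi (-b)) := by
  set u := act g vac
  have h1 : ∑ p ∈ Finset.HasAntidiagonal.antidiagonal b, shift (bra u (gam p.1)) p.2 =
      bra u (ell ∘ₗ phi (-b)) := by
    simp only [shift_bra, ← map_sum]
    congr 1
    refine LinearMap.ext fun v => ?_
    simp [sum_gam_comp]
  have h2 : gam 1 = 0 := LinearMap.ext gam_one
  -- The term i = 0 gives τ_0, i = 1 drops out, and i ≥ 2 gives the pairs, with 1/2 = 2 · 1/4.
  rw [← h1, Finset.Nat.sum_antidiagonal_eq_sum_range_succ fun i m => shift (bra u (gam i)) m,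
    ← Finset.sum_subset (s₁ := insert 0 (Finset.Icc 2 b)), Finset.sum_insert (by simp), smul_add]
  · unfold tauShift
    rw [tauZero_eq, Nat.sub_zero]
    congr 1
    rw [Finset.smul_sum, Finset.smul_sum]
    refine Finset.sum_congr rfl fun i _ => ?_
    rw [tauPair_eq, shift_eq, shift_eq, map_smul, smul_smul]
    norm_num
    rfl
  · intro i hi
    simp only [Finset.mem_insert, Finset.mem_Icc, Finset.mem_range] at hi ⊢
    omega
  · intro i hi hi'
    simp only [Finset.mem_insert, Finset.mem_Icc, Finset.mem_range] at hi hi'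
    obtain rfl : i = 1 := by omega
    rw [h2, map_zero, shift_eq, map_zero]

theorem waveNum_eq (g : List CInf) (i : ℤ) :
    waveNum (tauZero g) (tauPair g) i = braOne (phi i (act g vac)) := by
  set u := act g vac with hu
  ext n
  rw [braOne_eq, map_smul, coeff_bra_phi u n ell i (timeWeight n + 1) (Nat.lt_succ_self _)]
  change (∑ᶠ a : ℕ, if i ≤ (a : ℤ) then MvPowerSeries.coeff n
    (expXi a * tauShift (tauZero g) (tauPair g) ((a : ℤ) - i).toNat) else 0) = _
  have h : ∀ a : ℕ, (if i ≤ (a : ℤ) then MvPowerSeries.coeff n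
      (expXi a * tauShift (tauZero g) (tauPair g) ((a : ℤ) - i).toNat) else 0) =
      (1 / 2 : ℂ) * MvPowerSeries.coeff n (expXi a * bra u (ell ∘ₗ phi (i - a))) := by
    intro a
    split_ifs with hia
    · rw [tauShift_eq, ← hu, mul_smul_comm, map_smul, smul_eq_mul,
        show -((((a : ℤ) - i).toNat : ℕ) : ℤ) = i - a by omega]
    -- No positive powers of z occur: ⟨0|φ_{-1/2} is orthogonal to φ_{i-a} when i > a.
    · have : ell ∘ₗ phi (i - a) = 0 := LinearMap.ext fun v => ell_phi_pos (by omega) v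
      rw [this, map_zero, mul_zero, map_zero, mul_zero]
  simp only [h]
  rw [finsum_eq_sum_of_support_subset (s := Finset.range (timeWeight n + 1)), ← Finset.mul_sum,
    smul_eq_mul]
  intro a ha
  by_contra ha'
  rw [Finset.coe_range, Set.mem_Iio, not_lt] at ha'
  exact ha (by simp only [coeff_expXi_mul_eq_zero (show timeWeight n < a by omega), mul_zero])

/-! ### The bilinear equation -/

/-- Multiplication by c(t) c(t'). Bounding the powers of z from above, separately for each
coefficient, makes the residue a finite sum that can be exchanged with the two convolutions. -/
theorem BilinearEq.mul {k : ℕ} {w : ℤ → Times} {q₁ q₂ : Times} (h : BilinearEq k w q₁ q₂)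
    (hw : ∀ α, ∃ M : ℤ, ∀ i, M ≤ i → MvPowerSeries.coeff α (w i) = 0) (c : Times) :
    BilinearEq k (fun i => c * w i) (c * q₁) (c * q₂) := by
  classical
  have hfin : ∀ α β, Function.HasFiniteSupport fun i : ℤ => (-1 : ℂ) ^ (-(k : ℤ) - 1 - i) *
      MvPowerSeries.coeff α (w i) * MvPowerSeries.coeff β (w (-(k : ℤ) - 1 - i)) := by
    intro α β
    obtain ⟨M, hM⟩ := hw α
    obtain ⟨M', hM'⟩ := hw β
    refine (Set.finite_Icc (-(k : ℤ) - 1 - M') M).subset fun i hi => ?_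
    by_contra h
    refine hi ?_
    rw [Set.mem_Icc, not_and_or, not_le, not_le] at h
    rcases h with h | h
    · simp only [hM' _ (show M' ≤ -(k : ℤ) - 1 - i by omega), mul_zero]
    · simp only [hM _ h.le, mul_zero, zero_mul]
  intro α β
  have key : ∀ i : ℤ, (-1 : ℂ) ^ (-(k : ℤ) - 1 - i) * MvPowerSeries.coeff α (c * w i) *
      MvPowerSeries.coeff β (c * w (-(k : ℤ) - 1 - i)) =
      ∑ p ∈ Finset.HasAntidiagonal.antidiagonal α, ∑ q ∈ Finset.HasAntidiagonal.antidiagonal β,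
        MvPowerSeries.coeff p.1 c * MvPowerSeries.coeff q.1 c *
        ((-1 : ℂ) ^ (-(k : ℤ) - 1 - i) * MvPowerSeries.coeff p.2 (w i) *
          MvPowerSeries.coeff q.2 (w (-(k : ℤ) - 1 - i))) := by
    intro i
    rw [MvPowerSeries.coeff_mul, MvPowerSeries.coeff_mul, mul_assoc, Finset.sum_mul_sum,
      Finset.mul_sum]
    refine Finset.sum_congr rfl fun p _ => ?_
    rw [Finset.mul_sum]
    exact Finset.sum_congr rfl fun q _ => by ring
  simp only [key]
  have hfin' : ∀ p q : (ℕ →₀ ℕ) × (ℕ →₀ ℕ), Function.HasFiniteSupport fun i : ℤ =>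
      MvPowerSeries.coeff p.1 c * MvPowerSeries.coeff q.1 c *
        ((-1 : ℂ) ^ (-(k : ℤ) - 1 - i) * MvPowerSeries.coeff p.2 (w i) *
          MvPowerSeries.coeff q.2 (w (-(k : ℤ) - 1 - i))) := fun p q =>
    (hfin p.2 q.2).subset fun i hi h0 => hi (by simp only at h0 ⊢; rw [h0, mul_zero])
  rw [finsum_sum_comm]
  · have h2 : ∀ p ∈ Finset.HasAntidiagonal.antidiagonal α, (∑ᶠ i : ℤ,
        ∑ q ∈ Finset.HasAntidiagonal.antidiagonal β,
        MvPowerSeries.coeff p.1 c * MvPowerSeries.coeff q.1 c *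
        ((-1 : ℂ) ^ (-(k : ℤ) - 1 - i) * MvPowerSeries.coeff p.2 (w i) *
          MvPowerSeries.coeff q.2 (w (-(k : ℤ) - 1 - i)))) =
        ∑ q ∈ Finset.HasAntidiagonal.antidiagonal β,
        MvPowerSeries.coeff p.1 c * MvPowerSeries.coeff q.1 c *
        (MvPowerSeries.coeff p.2 q₁ * MvPowerSeries.coeff q.2 q₂ +
          MvPowerSeries.coeff p.2 q₂ * MvPowerSeries.coeff q.2 q₁) := by
      intro p _
      rw [finsum_sum_comm _ _ fun q _ => hfin' p q]
      refine Finset.sum_congr rfl fun q _ => ?_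
      rw [← mul_finsum, h p.2 q.2]
    rw [Finset.sum_congr rfl h2]
    simp only [MvPowerSeries.coeff_mul, Finset.sum_mul_sum, ← Finset.sum_add_distrib]
    exact Finset.sum_congr rfl fun p _ => Finset.sum_congr rfl fun q _ => by ring
  · intro p _
    refine ((Finset.HasAntidiagonal.antidiagonal β).finite_toSet.biUnion
      fun q _ => hfin' p q).subset fun i hi => ?_
    by_contra h'
    refine hi (Finset.sum_eq_zero fun q hq => ?_)
    by_contra h0
    exact h' (Set.mem_biUnion (Finset.mem_coe.2 hq) h0)

/-- The coefficients of `⟨1|e^{H(t)} u` are local functionals of `u`. -/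
theorem exists_local_braOne (n : ℕ →₀ ℕ) : ∃ κ : Fock →ₗ[ℂ] ℂ, IsLocal κ ∧
    ∀ u, κ u = MvPowerSeries.coeff n (braOne u) := by
  obtain ⟨T, hT, hTu⟩ := exists_expHL n
  refine ⟨(1 / 2 : ℂ) • (ell ∘ₗ T), (isLocal_ell.comp hT).smul _, fun u => ?_⟩
  rw [braOne_eq, map_smul, coeff_bra, LinearMap.smul_apply, LinearMap.comp_apply, hTu]

theorem bilinearEq_waveNum {k : ℕ} (hk : Odd k) {g : List CInf} (hg : InSp g)
    {f : ℤ → ℤ → ℂ} (hconj : ConjEq g k f) {d e : ℕ → ℂ}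
    (hf : ∀ l j : ℕ, 1 ≤ l → 1 ≤ j → f l j + f j l = -(d l * e j + e l * d j))
    (hd : InDom g (lin d)) (he : InDom g (lin e)) :
    BilinearEq k (fun i => (2 : ℂ) • waveNum (tauZero g) (tauPair g) i) (rho g d) (rho g e) := by
  intro α β
  obtain ⟨κ, hκ, hκu⟩ := exists_local_braOne α
  obtain ⟨κ', hκ', hκu'⟩ := exists_local_braOne β
  have h := bilinear_act_vac hk hg hconj hf hd he hκ hκ'
  simp only [waveNum_eq, rho, map_smul, ← hκu, ← hκu', smul_eq_mul]
  -- The factors 2 of the two wave series give 4, matching those of the two `rho`.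
  have h1 : ∀ i : ℤ, (-1 : ℂ) ^ (-(k : ℤ) - 1 - i) * (2 * κ (phi i (act g vac))) *
      (2 * κ' (phi (-(k : ℤ) - 1 - i) (act g vac))) = 4 * ((-1 : ℂ) ^ (-(k : ℤ) - 1 - i) *
        (κ (phi i (act g vac)) * κ' (phi (-(k : ℤ) - 1 - i) (act g vac)))) := fun i => by ring
  simp only [h1]
  rw [← mul_finsum, h]
  ring

theorem coeff_waveNum_eventually_zero (g : List CInf) (α : ℕ →₀ ℕ) : ∃ M : ℤ, ∀ i, M ≤ i →
    MvPowerSeries.coeff α ((2 : ℂ) • waveNum (tauZero g) (tauPair g) i) = 0 := by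
  obtain ⟨κ, hκ, hκu⟩ := exists_local_braOne α
  obtain ⟨M, hM⟩ := hκ.exists_phi_eq_zero
  exact ⟨M, fun i hi => by rw [waveNum_eq, map_smul, ← hκu, hM i hi, smul_zero]⟩

end CKP

end

theorem mainTheorem8 (k : ℕ) (hk : Odd k)
    (g : List CKP.CInf) (hg : CKP.InSp g)
    (f : ℤ → ℤ → ℂ) (hconj : CKP.ConjEq g k f)
    (d e : ℕ → ℂ)
    (hf : ∀ l j : ℕ, 1 ≤ l → 1 ≤ j →
      f l j + f j l = -(d l * e j + e l * d j))
    (hd : CKP.InDom g (CKP.lin d)) (he : CKP.InDom g (CKP.lin e)) :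
    -- the wave series of the tau functions is `⟨1|e^{H(t)} φ(z) g|0⟩`
    (∀ i : ℤ, CKP.waveNum (CKP.tauZero g) (CKP.tauPair g) i =
      CKP.braOne (CKP.phi i (CKP.act g CKP.vac))) ∧
    -- the bilinear equation multiplied by `τ_0(t) τ_0(t')`
    CKP.BilinearEq k
      (fun i => (2 : ℂ) • CKP.waveNum (CKP.tauZero g) (CKP.tauPair g) i)
      (CKP.rho g d) (CKP.rho g e) ∧
    -- the bilinear equation for the wave function `w` and `q_i = ϱ_i / τ_0`
    (MvPowerSeries.constantCoeff (CKP.tauZero g) ≠ 0 →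
      CKP.BilinearEq k (CKP.wave (CKP.tauZero g) (CKP.tauPair g))
        ((CKP.tauZero g)⁻¹ * CKP.rho g d) ((CKP.tauZero g)⁻¹ * CKP.rho g e)) := by
  refine ⟨CKP.waveNum_eq g, CKP.bilinearEq_waveNum hk hg hconj hf hd he, fun _ => ?_⟩
  -- The equation is divided by τ_0(t) τ_0(t').
  have h := (CKP.bilinearEq_waveNum hk hg hconj hf hd he).mul
    (CKP.coeff_waveNum_eventually_zero g) (CKP.tauZero g)⁻¹
  simp only [mul_smul_comm] at h
  exact h
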